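/- Let $m\ge 6$ be even, write $m=2t+2$, and let $R=\mathrm{RM}(m-3,m)$ be the binary Reed–Muller code of length $2^m$ (the evaluations on $\mathbb F_2^m$ of all polynomials in $m$ variables over $\mathbb F_2$ of degree at most $m-3$). **Goethals code.** Let $F$ be the field with $2^{m-1}$ elements and identify $\mathbb F_2^m$ with $F\times\mathbb F_2$ by an additive isomorphism, so that a binary word of length $2^m$ is a pair $(X,Y)$ of subsets of $F$ (the supports of the word on $F\times\{0\}$ and on $F\times\{1\}$). With $r=2^{t-1}+1$ and $s=2^t+1$, the Goethals code $\mathcal G(m)$ is the set of all $(X,Y)$ such that $|X|$ and $|Y|$ are even, $\sum_{x\in X}x=\sum_{y\in Y}y$, and, for $j\in\{r,s\}$, $$\sum_{x\in X}x^{j}+\Big(\sum_{x\in X}x\Big)^{j}=\sum_{y\in Y}y^{j}.$$ **Quantum codes.** For $a,b\in\mathbb F_2^n$ let $(a|b)$ denote the Pauli operator $\bigotimes_i\sigma_x^{a_i}\sigma_z^{b_i}$ on $(\mathbb C^2)^{\otimes n}$; its weight is the number of $i$ with $(a_i,b_i)\ne(0,0)$. A code $((n,K,d))$ is a $K$-dimensional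 subspace $Q\subseteq(\mathbb C^2)^{\otimes n}$ such that $d$ is the least weight of a Pauli operator $E$ for which there is no $c\in\mathbb C$ with $\langle\varphi|E|\psi\rangle=c\langle\varphi|\psi\rangle$ for all $\varphi,\psi\in Q$. A stabilizer (additive) code is the joint $+1$ eigenspace of an Abelian subgroup of the Pauli group $\{i^k(a|b)\}$ that contains no multiple of the identity other than the identity; it is denoted $[[n,k,d]]$ if it is an $((n,2^k,d))$ code. Then: 1. $R^\perp\subseteq R$, and the CSS code $\mathcal C_0$ of $R$, i.e. the joint $+1$ eigenspace of the operators $(a|0)$ and $(0|b)$ with $a,b\in R^\perp$, is a stabilizer code $[[2^m,\,2^m-2\binom m2-2m-2,\,8]]$. 2. $\mathcal G(m)$ is a union of cosets of $R$, and the number of these cosets is $K_G=2^{\binom m2-2m+2}$. 3. Let $T_1,T_2$ be any two sets of representatives of the cosets of $R$ in $\mathcal G(m)$. The translates $(t_1|t_2)\,\mathcal C_0$ with $t_1\in T_1$, $t_2\in T_2$ are pairwise orthogonal, and their direct sum (the CSS-like union code) is a quantum code $((2^m,\,2^{2^m-6m+2},\,8))$ which is non-additive, i.e. not a stabilizer code.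 For $m=6$ and $m=8$ it has the parameters $((64,2^{30},8))$ and $((256,2^{210},8))$. -/

import Mathlib

noncomputable section

namespace QCode

/-! ### Classical binary codes. Words of length `n` are functions `ι → ZMod 2`, `|ι| = n`. -/

/-- The dual of a linear binary code, for the standard inner product. -/
def dual {ι : Type*} [Fintype ι] (C : Submodule (ZMod 2) (ι → ZMod 2)) :
    Submodule (ZMod 2) (ι → ZMod 2) where
  carrier := {v | ∀ c ∈ C, v ⬝ᵥ c = 0}
  zero_mem' := by intro c _; simp
  add_mem' := by
    intro v w hv hw c hc
    rw [add_dotProduct, hv c hc, hw c hc, add_zero]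
  smul_mem' := by
    intro a v hv c hc
    rw [smul_dotProduct, hv c hc, smul_zero]

/-- The Reed-Muller code `RM(r, m)` of length `2 ^ m`: all evaluations on `𝔽₂ᵐ` of polynomials in
`m` variables of total degree at most `r`. -/
def reedMuller (r m : ℕ) : Submodule (ZMod 2) ((Fin m → ZMod 2) → ZMod 2) :=
  (MvPolynomial.restrictTotalDegree (Fin m) (ZMod 2) r).map
    (MvPolynomial.evalₗ (ZMod 2) (Fin m))

/-- For a word `c` whose coordinates are labelled by `F × 𝔽₂`, the set of those `x` in `F` for
which `c` has a one in position `(x, ε)`. -/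
def half {m : ℕ} {F : Type*} [Field F] [Fintype F]
    (e : (Fin m → ZMod 2) ≃+ F × ZMod 2) (c : (Fin m → ZMod 2) → ZMod 2) (ε : ZMod 2) :
    Finset F :=
  Finset.univ.filter fun x => c (e.symm (x, ε)) = 1

/-- The Goethals code of length `2 ^ m`, `m` even. Here `F` is the field with `2 ^ (m - 1)`
elements, and the coordinates are labelled by `F × 𝔽₂`, identified with `𝔽₂ᵐ` through `e`. A word
is a pair `(X, Y)` of subsets of `F`. With `m = 2 t + 2`, `r = 2 ^ (t - 1) + 1` and
`s = 2 ^ t + 1`, the pair is a codeword if `|X|` and `|Y|` are even, `∑ x = ∑ y`,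
`∑ x ^ r + (∑ x) ^ r = ∑ y ^ r` and `∑ x ^ s + (∑ x) ^ s = ∑ y ^ s`. -/
def goethals {m : ℕ} {F : Type*} [Field F] [Fintype F]
    (e : (Fin m → ZMod 2) ≃+ F × ZMod 2) : Set ((Fin m → ZMod 2) → ZMod 2) :=
  let r := 2 ^ (m / 2 - 2) + 1
  let s := 2 ^ (m / 2 - 1) + 1
  {c | Even (half e c 0).card ∧ Even (half e c 1).card ∧
    ∑ x ∈ half e c 0, x = ∑ y ∈ half e c 1, y ∧
    ∑ x ∈ half e c 0, x ^ r + (∑ x ∈ half e c 0, x) ^ r = ∑ y ∈ half e c 1, y ^ r ∧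
    ∑ x ∈ half e c 0, x ^ s + (∑ x ∈ half e c 0, x) ^ s = ∑ y ∈ half e c 1, y ^ s}

/-- `G` is the union of the cosets `R + t`, `t ∈ T`, and these cosets are pairwise distinct. -/
def IsCosetDecomposition {ι : Type*} (R : Submodule (ZMod 2) (ι → ZMod 2))
    (G : Set (ι → ZMod 2)) (T : Finset (ι → ZMod 2)) : Prop :=
  (G = ⋃ t ∈ T, {v | ∃ c ∈ R, v = c + t}) ∧ ∀ t ∈ T, ∀ t' ∈ T, t - t' ∈ R → t = t'

/-! ### Qubits, Pauli operators, stabilizer codes -/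

variable {ι : Type*} [Fintype ι] [DecidableEq ι]

/-- The state space `(ℂ²)^{⊗n}` of the qubits labelled by `ι`, with the computational basis
labelled by the binary words. -/
abbrev Qubits (ι : Type*) [Fintype ι] : Type _ := EuclideanSpace ℂ (ι → ZMod 2)

def sigmaX : Matrix (ZMod 2) (ZMod 2) ℂ := Matrix.of fun x y => if x = y + 1 then 1 else 0

def sigmaZ : Matrix (ZMod 2) (ZMod 2) ℂ := Matrix.diagonal fun x => if x = 0 then 1 else -1

/-- The tensor product over `i` of `σ_x ^ a_i σ_z ^ b_i`, denoted by the binary vector `(a|b)`. -/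
def pauli (a b : ι → ZMod 2) : Matrix (ι → ZMod 2) (ι → ZMod 2) ℂ :=
  Matrix.of fun x y => ∏ i, (sigmaX ^ (a i).val * sigmaZ ^ (b i).val) (x i) (y i)

/-- The operator on the state space given by `pauli a b`. -/
def pauliOp (a b : ι → ZMod 2) : Qubits ι →ₗ[ℂ] Qubits ι :=
  Matrix.toEuclideanLin (pauli a b)

/-- The number of tensor factors different from the identity. -/
def pauliWeight (a b : ι → ZMod 2) : ℕ :=
  (Finset.univ.filter fun i => a i ≠ 0 ∨ b i ≠ 0).card

/-- Membership in the Pauli group: `i ^ k` times a tensor product of Pauli matrices. -/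
def IsPauli (g : Matrix (ι → ZMod 2) (ι → ZMod 2) ℂ) : Prop :=
  ∃ (k : ℕ) (a b : ι → ZMod 2), g = Complex.I ^ k • pauli a b

/-- Additive (stabilizer) codes: joint `+1` eigenspaces of an Abelian subgroup of the Pauli group
which contains no non-trivial multiple of the identity. Other choices of the eigenvalues are
covered, the signs being absorbed in the group. -/
def IsStabilizerCode (Q : Submodule ℂ (Qubits ι)) : Prop :=
  ∃ S : Subgroup (Matrix (ι → ZMod 2) (ι → ZMod 2) ℂ)ˣ,
    (∀ g ∈ S, IsPauli g.val) ∧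
    (∀ g ∈ S, ∀ h ∈ S, g * h = h * g) ∧
    (∀ g ∈ S, ∀ c : ℂ, g.val = c • 1 → c = 1) ∧
    ∀ ψ : Qubits ι, ψ ∈ Q ↔ ∀ g ∈ S, Matrix.toEuclideanLin g.val ψ = ψ

/-- The condition that the code `Q` detects the Pauli error `(a|b)`. -/
def Detects (Q : Submodule ℂ (Qubits ι)) (a b : ι → ZMod 2) : Prop :=
  ∃ c : ℂ, ∀ φ ∈ Q, ∀ ψ ∈ Q, inner ℂ φ (pauliOp a b ψ) = c * inner ℂ φ ψ

/-- `d` is the minimum distance of `Q`: the least weight of a Pauli error not detected by `Q`. -/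
def HasMinDistance (Q : Submodule ℂ (Qubits ι)) (d : ℕ) : Prop :=
  IsLeast {w | ∃ a b : ι → ZMod 2, ¬ Detects Q a b ∧ pauliWeight a b = w} d

/-- `Q` is a quantum code `((n, K, d))`: a `K`-dimensional space of states of `n` qubits, of
minimum distance `d`. -/
def IsCode (Q : Submodule ℂ (Qubits ι)) (n K d : ℕ) : Prop :=
  Fintype.card ι = n ∧ Module.finrank ℂ Q = K ∧ HasMinDistance Q d

/-- The CSS code of `C₁`, `C₂` (where `C₂^⊥ ⊆ C₁`): its stabilizer is generated by the operators
`(a|0)` with `a ∈ C₂^⊥` and `(0|b)` with `b ∈ C₁^⊥`. -/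
def cssCode (C₁ C₂ : Submodule (ZMod 2) (ι → ZMod 2)) : Submodule ℂ (Qubits ι) :=
  (⨅ a ∈ dual C₂, LinearMap.eqLocus (pauliOp a 0) LinearMap.id) ⊓
    ⨅ b ∈ dual C₁, LinearMap.eqLocus (pauliOp 0 b) LinearMap.id

/-- The translate `t Q` of `Q` by the Pauli operator `t = (a|b)`. -/
def translate (Q : Submodule ℂ (Qubits ι)) (t : (ι → ZMod 2) × (ι → ZMod 2)) :
    Submodule ℂ (Qubits ι) :=
  Q.map (pauliOp t.1 t.2)

/-- The union code: the sum of the translates of `Q` by the elements of `T`. -/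
def unionCode (Q : Submodule ℂ (Qubits ι)) (T : Finset ((ι → ZMod 2) × (ι → ZMod 2))) :
    Submodule ℂ (Qubits ι) :=
  ⨆ t ∈ T, translate Q t

/-- The CSS-like union code: the union code of the CSS code of `C₁`, `C₂` with the translations
`(t₁|t₂)`, `t₁ ∈ T₁`, `t₂ ∈ T₂`. -/
def cssUnionCode (C₁ C₂ : Submodule (ZMod 2) (ι → ZMod 2)) (T₁ T₂ : Finset (ι → ZMod 2)) :
    Submodule ℂ (Qubits ι) :=
  unionCode (cssCode C₁ C₂) (T₁ ×ˢ T₂)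

end QCode

end

/-! Write `m = 2 * k + 4`, so that `t = k + 1` and the Goethals exponents are `2 ^ k + 1` and `2 ^
(k + 1) + 1`, and let `R = RM(m-3, m)`.

Classical side. The Goethals code is the preimage, under a surjective `𝔽₂`-linear moment map, of the
curve of targets `(0, S, 0, S, S ^ r, S ^ s)`, `S ∈ F` (`mem_goethals_iff`,
`goethalsMoments_surjective`). The moments pair a word with polynomials of degree at most two,
because `x ^ (2 ^ n + 1)` is a Frobenius image of `x` times `x`. They therefore vanish on `R`, whose
dual is `RM(2, m)`, and the code is a union of cosets of `R`. Comparing the sizes of fibres counts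
the cosets. The curve is not closed under addition, so the code is not linear.

Distance eight. A translation of one half turns the difference of two codewords into a codeword, so
it is enough to exclude nonzero words of weight below eight. The evenness conditions leave halves of
sizes `0` and at most `6`, or `2` and at most `4`. Frobenius turns the two power sums into moments
of `z ^ i * y ^ j`, with `z = y ^ (2 ^ (k + 2))`, `i ∈ {1, 2}`, `j ∈ {1, 2, 4}`. A polynomial in `z`
serves as a weight on the points, and interpolation by `1, y, y ^ 2, y ^ 4` then forces this weight
to vanish where it cannot (`weight_eq_zero_of_four_moments`).

Quantum side. The translate of the CSS code by `(t₁|t₂)` is the joint eigenspace of the CSS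
stabilizer with signs given by `t₁` and `t₂`; it depends only on their cosets modulo `R`, and
different pairs of cosets give orthogonal spaces. A Pauli error `(a|b)` adds `(a, b)` to this label.
If its weight is below eight and it is not the identity, the distance of the Goethals code prevents
it from joining two translates, so it is detected. A weight-eight word of `R` outside `R^⊥` is an
undetected error already for the CSS code. Finally, the bit-flip words `t` that keep a fixed CSS
state in a stabilizer code are closed under addition, whereas those for the union code form the
Goethals code. -/

noncomputable section

namespace QCode

/-! ### Power sums over finite sets in characteristic two -/

section PowerSums

variable {F : Type*} [Field F]

/-- Interpolation by `1, y, y ^ 2, y ^ 4` on four points whose sum does not vanish. -/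
theorem weight_eq_zero_of_four_moments (Y : Finset F) (a : F → F) {p q u v : F}
    (hp : p ∈ Y) (ha : ∀ y ∈ Y, y ≠ p → y ≠ q → y ≠ u → y ≠ v → a y = 0)
    (h0 : ∑ y ∈ Y, a y = 0) (h1 : ∑ y ∈ Y, a y * y = 0) (h2 : ∑ y ∈ Y, a y * y ^ 2 = 0)
    (h4 : ∑ y ∈ Y, a y * y ^ 4 = 0) (hpq : p ≠ q) (hpu : p ≠ u) (hpv : p ≠ v)
    (hs : p + q + u + v ≠ 0) : a p = 0 := by
  -- The last factor cancels the `y ^ 3` term of the product, leaving a combination of `1, y, y ^ 2,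
  -- y ^ 4`. At `p` it is the nonzero sum of the four points.
  have key : ∑ y ∈ Y, a y * ((y - q) * (y - u) * (y - v) * (y + q + u + v)) = 0 := by
    have : ∀ y, a y * ((y - q) * (y - u) * (y - v) * (y + q + u + v)) =
        a y * y ^ 4 + ((q * u + q * v + u * v) - (q + u + v) ^ 2) * (a y * y ^ 2)
        + (-(q * u * v) + (q + u + v) * (q * u + q * v + u * v)) * (a y * y)
        + (-(q * u * v) * (q + u + v)) * a y := by intro y; ring
    simp only [this, Finset.sum_add_distrib, ← Finset.mul_sum, h0, h1, h2, h4]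
    ring
  rw [Finset.sum_eq_single p] at key
  · have hne : (p - q) * (p - u) * (p - v) * (p + q + u + v) ≠ 0 :=
      mul_ne_zero (mul_ne_zero (mul_ne_zero (sub_ne_zero.2 hpq) (sub_ne_zero.2 hpu))
        (sub_ne_zero.2 hpv)) hs
    exact (mul_eq_zero.1 key).resolve_right hne
  · intro y hy hyp
    by_cases hq : y = q
    · simp [hq]
    by_cases hu : y = u
    · simp [hu]
    by_cases hv : y = v
    · simp [hv]
    rw [ha y hy hyp hq hu hv, zero_mul]
  · exact fun h => absurd hp h

variable [CharP F 2]

/-- Sums of the values at the points of `Y` of the monomials `z ^ i * y ^ j`, `z = y ^ (2 ^ (k + 2))`,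
deduced by Frobenius from the power sums with exponents `2 ^ k + 1` and `2 ^ (k + 1) + 1`. -/
theorem mixed_moments {k : ℕ} (hF : ∀ x : F, x ^ 2 ^ (2 * k + 3) = x) (Y : Finset F)
    (hr : ∑ y ∈ Y, y ^ (2 ^ k + 1) = 0) (hs : ∑ y ∈ Y, y ^ (2 ^ (k + 1) + 1) = 0) :
    (∑ y ∈ Y, y ^ 2 ^ (k + 2) * y = 0 ∧ ∑ y ∈ Y, y ^ 2 ^ (k + 2) * y ^ 2 = 0 ∧
      ∑ y ∈ Y, y ^ 2 ^ (k + 2) * y ^ 4 = 0) ∧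
    (∑ y ∈ Y, (y ^ 2 ^ (k + 2)) ^ 2 * y = 0 ∧ ∑ y ∈ Y, (y ^ 2 ^ (k + 2)) ^ 2 * y ^ 2 = 0 ∧
      ∑ y ∈ Y, (y ^ 2 ^ (k + 2)) ^ 2 * y ^ 4 = 0) := by
  have : Fact (Nat.Prime 2) := ⟨Nat.prime_two⟩
  have frob : ∀ (n : ℕ) (f : F → F), ∑ y ∈ Y, f y = 0 → ∑ y ∈ Y, f y ^ 2 ^ n = 0 := by
    intro n f h
    rw [← sum_pow_char_pow 2, h, zero_pow (by positivity)]
  -- The exponents `k + 1` and `k + 2` add up to the degree `2 * k + 3` of the field, so this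
  -- Frobenius power brings `y ^ 2 ^ (k + 1)` back to `y`. The pair `k`, `k + 3` plays the same role
  -- in `b1`.
  have a1 : ∑ y ∈ Y, y ^ 2 ^ (k + 2) * y = 0 := by
    rw [← frob (k + 2) _ hs]
    refine Finset.sum_congr rfl fun y _ => ?_
    rw [pow_succ y, mul_pow, ← pow_mul y, ← pow_add 2]
    rw [show k + 1 + (k + 2) = 2 * k + 3 by ring, hF, mul_comm]
  have a2 : ∑ y ∈ Y, y ^ 2 ^ (k + 2) * y ^ 2 = 0 := by
    rw [← frob 1 _ hs]
    refine Finset.sum_congr rfl fun y _ => ?_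
    ring
  have a4 : ∑ y ∈ Y, y ^ 2 ^ (k + 2) * y ^ 4 = 0 := by
    rw [← frob 2 _ hr]
    refine Finset.sum_congr rfl fun y _ => ?_
    ring
  have b1 : ∑ y ∈ Y, (y ^ 2 ^ (k + 2)) ^ 2 * y = 0 := by
    rw [← frob (k + 3) _ hr]
    refine Finset.sum_congr rfl fun y _ => ?_
    rw [pow_succ y, mul_pow, ← pow_mul y (2 ^ k), ← pow_add 2]
    rw [show k + (k + 3) = 2 * k + 3 by ring, hF]
    ring
  refine ⟨⟨a1, a2, a4⟩, b1, ?_, ?_⟩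
  · rw [← frob 1 _ a1]
    exact Finset.sum_congr rfl fun y _ => by ring
  · rw [← frob 1 _ a2]
    exact Finset.sum_congr rfl fun y _ => by ring

theorem pow_two_pow_injective (n : ℕ) : Function.Injective fun y : F => y ^ 2 ^ n := by
  have : Fact (Nat.Prime 2) := ⟨Nat.prime_two⟩
  intro x y h
  exact iterateFrobenius_inj F 2 n (by simpa [iterateFrobenius_def] using h)

/-- Sums over an affine image of a set. -/
theorem sum_affine_pow (n : ℕ) (Y : Finset F) (hY : Even Y.card) (l a : F) :
    ∑ y ∈ Y, (l * (y + a)) ^ (2 ^ n + 1) = l ^ (2 ^ n + 1) *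
      (∑ y ∈ Y, y ^ (2 ^ n + 1) + a ^ 2 ^ n * ∑ y ∈ Y, y + a * (∑ y ∈ Y, y) ^ 2 ^ n) := by
  have : Fact (Nat.Prime 2) := ⟨Nat.prime_two⟩
  have hc : (Y.card : F) = 0 := (CharP.cast_eq_zero_iff F 2 _).2 hY.two_dvd
  have : ∀ y : F, (l * (y + a)) ^ (2 ^ n + 1) = l ^ (2 ^ n + 1) *
      (y ^ (2 ^ n + 1) + a ^ 2 ^ n * y + a * y ^ 2 ^ n + a ^ (2 ^ n + 1)) := by
    intro y
    rw [mul_pow, pow_succ (y + a), add_pow_char_pow]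
    ring
  have hlin : ∀ c : F, ∑ y ∈ Y, c * y = c * ∑ y ∈ Y, y := fun c => (Finset.mul_sum ..).symm
  simp only [this, ← Finset.mul_sum, Finset.sum_add_distrib, Finset.sum_const, nsmul_eq_mul, hc,
    sum_pow_char_pow 2, hlin]
  ring

/-- No nonempty set of at most six points, of even cardinality, has vanishing power sums with
exponents `1`, `2 ^ k + 1` and `2 ^ (k + 1) + 1`. -/
theorem eq_empty_of_power_sums {k : ℕ} (hF : ∀ x : F, x ^ 2 ^ (2 * k + 3) = x) (Y : Finset F)
    (hY : Even Y.card) (hcard : Y.card < 8) (h1 : ∑ y ∈ Y, y = 0)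
    (hr : ∑ y ∈ Y, y ^ (2 ^ k + 1) = 0) (hs : ∑ y ∈ Y, y ^ (2 ^ (k + 1) + 1) = 0) : Y = ∅ := by
  classical
  have : Fact (Nat.Prime 2) := ⟨Nat.prime_two⟩
  have hc : (Y.card : F) = 0 := (CharP.cast_eq_zero_iff F 2 _).2 hY.two_dvd
  obtain ⟨⟨a1, a2, a4⟩, b1, b2, b4⟩ := mixed_moments hF Y hr hs
  have hz : ∀ n, ∑ y ∈ Y, y ^ 2 ^ n = 0 := fun n => by
    rw [← sum_pow_char_pow 2, h1, zero_pow (by positivity)]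
  have hz2 : ∑ y ∈ Y, (y ^ 2 ^ (k + 2)) ^ 2 = 0 := by
    rw [← hz (k + 3)]; exact Finset.sum_congr rfl fun y _ => by ring
  have h2 : ∑ y ∈ Y, y ^ 2 = 0 := by simpa using hz 1
  have h4 : ∑ y ∈ Y, y ^ 4 = 0 := by simpa using hz 2
  have inj := pow_two_pow_injective (F := F) (k + 2)
  by_contra hne
  have hcases : Y.card = 2 ∨ Y.card = 4 ∨ Y.card = 6 := by
    have : Y.card ≠ 0 := by simpa using hne
    obtain ⟨n, hn⟩ := hY
    omega
  rcases hcases with h | h | h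
  · obtain ⟨x, y, hxy, rfl⟩ := Finset.card_eq_two.1 h
    rw [Finset.sum_pair hxy] at h1
    exact hxy (CharTwo.add_eq_zero.1 h1)
  · obtain ⟨p, Y', hp, hY', h'⟩ := Finset.card_eq_succ.1 h
    obtain ⟨q, u, v, hqu, hqv, huv, rfl⟩ := Finset.card_eq_three.1 h'
    simp only [Finset.mem_insert, Finset.mem_singleton, not_or] at hp
    obtain ⟨hpq, hpu, hpv⟩ := hp
    -- This test function is a combination of monomials with vanishing moments. Among the four
    -- points it is nonzero only at `p`, since `y ↦ z` is injective.
    have key : ∑ y ∈ Y, (y ^ 2 ^ (k + 2) - v ^ 2 ^ (k + 2)) * ((y - q) * (y - u)) = 0 := by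
      have : ∀ y, (y ^ 2 ^ (k + 2) - v ^ 2 ^ (k + 2)) * ((y - q) * (y - u)) =
          y ^ 2 ^ (k + 2) * y ^ 2 - (q + u) * (y ^ 2 ^ (k + 2) * y) + q * u * y ^ 2 ^ (k + 2)
          - v ^ 2 ^ (k + 2) * y ^ 2 + v ^ 2 ^ (k + 2) * (q + u) * y
          + -(v ^ 2 ^ (k + 2) * (q * u)) * 1 := by intro y; ring
      have hlin : ∀ c : F, ∑ y ∈ Y, c * y = 0 := fun c => by rw [← Finset.mul_sum, h1, mul_zero]
      simp only [this, Finset.sum_add_distrib, Finset.sum_sub_distrib, ← Finset.mul_sum, a1, a2,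
        hlin, h2, hz, Finset.sum_const, nsmul_eq_mul, hc]
      ring
    have hpY : p ∈ Y := by rw [← hY']; simp
    rw [Finset.sum_eq_single p] at key
    · refine mul_ne_zero (sub_ne_zero.2 fun h => hpv (inj h))
        (mul_ne_zero (sub_ne_zero.2 hpq) (sub_ne_zero.2 hpu)) key
    · intro y hy hyp
      rw [← hY'] at hy
      simp only [Finset.mem_insert, Finset.mem_singleton, hyp, false_or] at hy
      rcases hy with rfl | rfl | rfl <;> simp
    · exact fun h => absurd hpY h
  · obtain ⟨a, Y₁, ha, hY₁, h'⟩ := Finset.card_eq_succ.1 h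
    obtain ⟨b, Y₂, hb, rfl, h''⟩ := Finset.card_eq_succ.1 h'
    obtain ⟨p, Y₃, hp, rfl, h'''⟩ := Finset.card_eq_succ.1 h''
    obtain ⟨q, u, v, hqu, hqv, huv, rfl⟩ := Finset.card_eq_three.1 h'''
    simp only [Finset.mem_insert, Finset.mem_singleton, not_or] at ha hb hp
    set A := a ^ 2 ^ (k + 2)
    set B := b ^ 2 ^ (k + 2)
    -- The weight `(z - A) * (z - B)` removes two of the six points. The other four have sum `a + b
    -- ≠ 0`, as the interpolation lemma requires.
    have hexp : ∀ f : F → F, ∑ y ∈ Y, f y = 0 → ∑ y ∈ Y, y ^ 2 ^ (k + 2) * f y = 0 →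
        ∑ y ∈ Y, (y ^ 2 ^ (k + 2)) ^ 2 * f y = 0 →
        ∑ y ∈ Y, ((y ^ 2 ^ (k + 2) - A) * (y ^ 2 ^ (k + 2) - B)) * f y = 0 := by
      intro f h0 h1 h2
      have : ∀ y, ((y ^ 2 ^ (k + 2) - A) * (y ^ 2 ^ (k + 2) - B)) * f y =
        (y ^ 2 ^ (k + 2)) ^ 2 * f y - (A + B) * (y ^ 2 ^ (k + 2) * f y) + A * B * f y := by
        intro y; ring
      simp only [this, Finset.sum_add_distrib, Finset.sum_sub_distrib, ← Finset.mul_sum, h0, h1, h2]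
      ring
    have hsum : a + b + (p + q + u + v) = 0 := by
      rw [← h1, ← hY₁, Finset.sum_insert, Finset.sum_insert, Finset.sum_insert, Finset.sum_insert,
        Finset.sum_pair huv]
      · ring
      all_goals simp; try tauto
    have := weight_eq_zero_of_four_moments Y
      (fun y => (y ^ 2 ^ (k + 2) - A) * (y ^ 2 ^ (k + 2) - B)) (p := p) (q := q) (u := u) (v := v)
      (by rw [← hY₁]; simp) (by
        intro y hy h1 h2 h3 h4
        rw [← hY₁] at hy
        simp only [Finset.mem_insert, Finset.mem_singleton, h1, h2, h3, h4, or_false] at hy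
        rcases hy with rfl | rfl <;> simp [A, B])
      (by simpa using hexp (fun _ => 1) (by simp [hc]) (by simpa using hz _) (by simpa using hz2))
      (hexp _ h1 a1 b1) (hexp _ h2 a2 b2) (hexp _ h4 a4 b4) hp.1 hp.2.1 hp.2.2
      (fun h0 => ha.1 (CharTwo.add_eq_zero.1 (by simpa [h0] using hsum)))
    rcases mul_eq_zero.1 this with h0 | h0
    · exact ha.2.1 (inj (sub_eq_zero.1 h0)).symm
    · exact hb.1 (inj (sub_eq_zero.1 h0)).symm

/-- No set of two or four points has power sums `1`, `0`, `0` with exponents `1`, `2 ^ k + 1` and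
`2 ^ (k + 1) + 1`. -/
theorem false_of_power_sums_one {k : ℕ} (hF : ∀ x : F, x ^ 2 ^ (2 * k + 3) = x) (Y : Finset F)
    (hcard : Y.card = 2 ∨ Y.card = 4) (h1 : ∑ y ∈ Y, y = 1)
    (hr : ∑ y ∈ Y, y ^ (2 ^ k + 1) = 0) (hs : ∑ y ∈ Y, y ^ (2 ^ (k + 1) + 1) = 0) : False := by
  classical
  have : Fact (Nat.Prime 2) := ⟨Nat.prime_two⟩
  obtain ⟨⟨a1, a2, a4⟩, b1, b2, b4⟩ := mixed_moments hF Y hr hs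
  have hz : ∀ n, ∑ y ∈ Y, y ^ 2 ^ n = 1 := fun n => by
    rw [← sum_pow_char_pow 2, h1, one_pow]
  have hz2 : ∑ y ∈ Y, (y ^ 2 ^ (k + 2)) ^ 2 = 1 := by
    rw [← hz (k + 3)]; exact Finset.sum_congr rfl fun y _ => by ring
  have inj := pow_two_pow_injective (F := F) (k + 2)
  rcases hcard with h | h
  · obtain ⟨x, y, hxy, rfl⟩ := Finset.card_eq_two.1 h
    simp only [Finset.sum_pair hxy] at h1 a1 a2 hz
    have hx : x ^ 2 ^ (k + 2) = y ^ 2 ^ (k + 2) + 1 := by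
      rw [← hz (k + 2)]; linear_combination -(y ^ 2 ^ (k + 2)) * CharTwo.two_eq_zero (R := F)
    have hy : x = y + 1 := by
      rw [← h1]; linear_combination -y * CharTwo.two_eq_zero (R := F)
    rw [hx, hy] at a1 a2
    have e1 : y ^ 2 ^ (k + 2) = y + 1 := by
      linear_combination a1 - (y ^ 2 ^ (k + 2) * y + y + 1) * CharTwo.two_eq_zero (R := F)
    have e2 : y ^ 2 = y := by
      rw [e1] at a2
      linear_combination a2 - (y ^ 3 + 2 * y ^ 2 + 3 * y + 1) * CharTwo.two_eq_zero (R := F)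
    have e3 : ∀ n, y ^ 2 ^ n = y := by
      intro n
      induction n with
      | zero => simp
      | succ n ih => rw [pow_succ, pow_mul, ih, e2]
    rw [e3] at e1
    simp at e1
  · have hc : (Y.card : F) = 0 := (CharP.cast_eq_zero_iff F 2 _).2 (by rw [h]; norm_num)
    -- The weight `z + z ^ 2` has total `1 + 1 = 0` and no mixed moments, so interpolation makes it
    -- vanish at each point. Four distinct values of `z` do not fit in `{0, 1}`.
    have hfix : ∀ p ∈ Y, p ^ 2 ^ (k + 2) = 0 ∨ p ^ 2 ^ (k + 2) = 1 := by
      intro p hpY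
      obtain ⟨q, u, v, hqu, hqv, huv, h'⟩ := Finset.card_eq_three.1
        (show (Y.erase p).card = 3 by rw [Finset.card_erase_of_mem hpY, h])
      have hY : Y = {p, q, u, v} := by rw [← h', Finset.insert_erase hpY]
      have hp : p ∉ ({q, u, v} : Finset F) := by rw [← h']; simp
      have hsum : p + q + u + v = 1 := by
        rw [← h1, hY, Finset.sum_insert hp, Finset.sum_insert, Finset.sum_pair huv]
        · ring
        · simp [hqu, hqv]
      simp only [Finset.mem_insert, Finset.mem_singleton, not_or] at hp
      have hexp : ∀ f : F → F, ∑ y ∈ Y, y ^ 2 ^ (k + 2) * f y + 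
          ∑ y ∈ Y, (y ^ 2 ^ (k + 2)) ^ 2 * f y = 0 →
          ∑ y ∈ Y, (y ^ 2 ^ (k + 2) + (y ^ 2 ^ (k + 2)) ^ 2) * f y = 0 := by
        intro f h
        simpa only [add_mul, Finset.sum_add_distrib] using h
      have := weight_eq_zero_of_four_moments Y
        (fun y => y ^ 2 ^ (k + 2) + (y ^ 2 ^ (k + 2)) ^ 2) (p := p) (q := q) (u := u) (v := v)
        hpY (by
          intro y hy h1 h2 h3 h4
          rw [hY] at hy
          simp [h1, h2, h3, h4] at hy)
        (by simpa [Finset.sum_add_distrib, hz, hz2] using CharTwo.add_self_eq_zero (1 : F))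
        (hexp (fun y => y) (by rw [a1, b1, add_zero]))
        (hexp (fun y => y ^ 2) (by rw [a2, b2, add_zero]))
        (hexp (fun y => y ^ 4) (by rw [a4, b4, add_zero])) hp.1 hp.2.1 hp.2.2
        (by rw [hsum]; exact one_ne_zero)
      have : p ^ 2 ^ (k + 2) * (1 + p ^ 2 ^ (k + 2)) = 0 := by linear_combination this
      rcases mul_eq_zero.1 this with h0 | h0
      · exact Or.inl h0
      · exact Or.inr (CharTwo.add_eq_zero.1 h0).symm
    have hle : Y.card ≤ ({0, 1} : Finset F).card := by
      rw [← Finset.card_image_of_injective Y inj]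
      refine Finset.card_le_card fun z hz => ?_
      obtain ⟨p, hp, rfl⟩ := Finset.mem_image.1 hz
      simpa using hfix p hp
    have := hle.trans Finset.card_le_two
    omega

/-- The minimum weight of the Goethals code is eight. -/
theorem goethals_pair_eq_empty {k : ℕ} (hF : ∀ x : F, x ^ 2 ^ (2 * k + 3) = x) (X Y : Finset F)
    (hX : Even X.card) (hY : Even Y.card) (hcard : X.card + Y.card < 8)
    (h1 : ∑ x ∈ X, x = ∑ y ∈ Y, y)
    (hr : ∑ x ∈ X, x ^ (2 ^ k + 1) + (∑ x ∈ X, x) ^ (2 ^ k + 1) = ∑ y ∈ Y, y ^ (2 ^ k + 1))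
    (hs : ∑ x ∈ X, x ^ (2 ^ (k + 1) + 1) + (∑ x ∈ X, x) ^ (2 ^ (k + 1) + 1) =
      ∑ y ∈ Y, y ^ (2 ^ (k + 1) + 1)) : X = ∅ ∧ Y = ∅ := by
  classical
  have : Fact (Nat.Prime 2) := ⟨Nat.prime_two⟩
  wlog hle : X.card ≤ Y.card generalizing X Y
  · refine (this Y X hY hX (by omega) h1.symm ?_ ?_ (by omega)).symm
    · rw [← hr, ← h1, add_assoc, CharTwo.add_self_eq_zero, add_zero]
    · rw [← hs, ← h1, add_assoc, CharTwo.add_self_eq_zero, add_zero]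
  have hcases : X.card = 0 ∨ X.card = 2 ∧ (Y.card = 2 ∨ Y.card = 4) := by
    obtain ⟨i, hi⟩ := hX
    obtain ⟨j, hj⟩ := hY
    omega
  rcases hcases with h | ⟨h, hcY⟩
  · obtain rfl := Finset.card_eq_zero.1 h
    refine ⟨rfl, eq_empty_of_power_sums hF Y hY (by omega) (by simpa using h1.symm) ?_ ?_⟩
    · simpa using hr.symm
    · simpa using hs.symm
  · exfalso
    obtain ⟨x, x', hxx, rfl⟩ := Finset.card_eq_two.1 h
    simp only [Finset.sum_pair hxx] at h1 hr hs
    set S := x + x' with hS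
    have hS0 : S ≠ 0 := fun h0 => hxx (CharTwo.add_eq_zero.1 h0)
    have hx' : x' = x + S := by
      rw [hS]; linear_combination -x * CharTwo.two_eq_zero (R := F)
    -- The affine map `y ↦ S⁻¹ * (y + x)` normalizes `X` to `{0, 1}`; the image of `Y` then has
    -- power sums `1, 0, 0`.
    have aux : ∀ n, x ^ (2 ^ n + 1) + x' ^ (2 ^ n + 1) + S ^ (2 ^ n + 1) =
        ∑ y ∈ Y, y ^ (2 ^ n + 1) → ∑ y ∈ Y.image (fun y => S⁻¹ * (y + x)), y ^ (2 ^ n + 1) = 0 := by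
      intro n hn
      rw [Finset.sum_image (fun a _ b _ hab => by simpa [hS0] using hab), sum_affine_pow n Y hY,
        ← hn, ← h1, hx', pow_succ (x + S), add_pow_char_pow]
      linear_combination S⁻¹ ^ (2 ^ n + 1) * (x ^ (2 ^ n + 1) + S ^ (2 ^ n + 1) + x ^ 2 ^ n * S
        + S ^ 2 ^ n * x) * CharTwo.two_eq_zero (R := F)
    have hinj : Function.Injective fun y : F => S⁻¹ * (y + x) := fun a b hab => by
      simpa [hS0] using hab
    refine false_of_power_sums_one hF (Y.image fun y => S⁻¹ * (y + x))
      (by rwa [Finset.card_image_of_injective _ hinj]) ?_ (aux k hr) (aux (k + 1) hs)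
    have hc : (Y.card : F) = 0 := (CharP.cast_eq_zero_iff F 2 _).2 hY.two_dvd
    rw [Finset.sum_image fun a _ b _ hab => hinj hab, ← Finset.mul_sum, Finset.sum_add_distrib, ← h1]
    simp [hc, hS0]

end PowerSums

/-! ### Duality of binary codes -/

section Dual

variable {ι : Type*} [Fintype ι]

theorem mem_dual {C : Submodule (ZMod 2) (ι → ZMod 2)} {v : ι → ZMod 2} :
    v ∈ dual C ↔ ∀ c ∈ C, v ⬝ᵥ c = 0 := Iff.rfl

theorem dual_eq_orthogonal (C : Submodule (ZMod 2) (ι → ZMod 2)) :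
    dual C = LinearMap.BilinForm.orthogonal (dotProductBilin (ZMod 2) (ZMod 2)) C := by
  ext v
  rw [mem_dual, LinearMap.BilinForm.mem_orthogonal_iff]
  refine forall₂_congr fun c _ => ?_
  rw [dotProduct_comm]
  rfl

theorem dotProduct_nondegenerate : LinearMap.BilinForm.Nondegenerate
    (dotProductBilin (ZMod 2) (ZMod 2) : LinearMap.BilinForm (ZMod 2) (ι → ZMod 2)) := by
  classical
  constructor
  · intro v h
    funext i
    simpa using h (Pi.single i 1)
  · intro v h
    funext i
    simpa using h (Pi.single i 1)

theorem finrank_dual_add (C : Submodule (ZMod 2) (ι → ZMod 2)) :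
    Module.finrank (ZMod 2) (dual C) + Module.finrank (ZMod 2) C = Fintype.card ι := by
  have h := LinearMap.BilinForm.finrank_orthogonal dotProduct_nondegenerate C
  have hle := Submodule.finrank_le C
  rw [← dual_eq_orthogonal] at h
  rw [Module.finrank_fintype_fun_eq_card] at h hle
  omega

theorem dual_dual (C : Submodule (ZMod 2) (ι → ZMod 2)) : dual (dual C) = C := by
  rw [dual_eq_orthogonal, dual_eq_orthogonal]
  refine LinearMap.BilinForm.orthogonal_orthogonal dotProduct_nondegenerate ?_ C
  intro v w h
  exact (dotProduct_comm w v).trans h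

end Dual

/-! ### Reed-Muller codes -/

section ReedMuller

variable {m : ℕ}

/-- The evaluation of the square-free monomial with set of variables `S`. -/
def monomialWord (S : Finset (Fin m)) : (Fin m → ZMod 2) → ZMod 2 := fun v => ∏ i ∈ S, v i

theorem mem_reedMuller {r : ℕ} {c : (Fin m → ZMod 2) → ZMod 2} :
    c ∈ reedMuller r m ↔
      ∃ p : MvPolynomial (Fin m) (ZMod 2), p.totalDegree ≤ r ∧ ∀ v, MvPolynomial.eval v p = c v := by
  simp only [reedMuller, Submodule.mem_map, MvPolynomial.mem_restrictTotalDegree, funext_iff,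
    MvPolynomial.evalₗ_apply]

theorem monomialWord_mem_reedMuller {r : ℕ} {S : Finset (Fin m)} (hS : S.card ≤ r) :
    monomialWord S ∈ reedMuller r m := by
  refine mem_reedMuller.2 ⟨∏ i ∈ S, MvPolynomial.X i, ?_, fun v => ?_⟩
  · refine (MvPolynomial.totalDegree_finsetProd _ _).trans ?_
    simpa using hS
  · simp [monomialWord]

theorem reedMuller_eq_span (r : ℕ) :
    reedMuller r m = Submodule.span (ZMod 2)
      (Set.range fun S : {S : Finset (Fin m) // S.card ≤ r} => monomialWord S.1) := by
  refine le_antisymm ?_ ?_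
  · intro c hc
    obtain ⟨p, hp, hpc⟩ := mem_reedMuller.1 hc
    have hc' : c = ∑ d ∈ p.support, p.coeff d • monomialWord d.support := by
      funext v
      rw [← hpc, MvPolynomial.eval_eq, Finset.sum_apply]
      refine Finset.sum_congr rfl fun d _ => ?_
      rw [Pi.smul_apply, smul_eq_mul, monomialWord]
      congr 1
      refine Finset.prod_congr rfl fun i hi => ?_
      have hpow : ∀ (x : ZMod 2) (n : ℕ), x ^ (n + 1) = x := by
        intro x n
        induction n with
        | zero => simp
        | succ n ih => rw [pow_succ, ih]; clear ih; revert x; decide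
      obtain ⟨n, hn⟩ := Nat.exists_eq_succ_of_ne_zero (Finsupp.mem_support_iff.1 hi)
      rw [hn, hpow]
    rw [hc']
    refine Submodule.sum_mem _ fun d hd => Submodule.smul_mem _ _ (Submodule.subset_span ?_)
    refine ⟨⟨d.support, ?_⟩, rfl⟩
    refine le_trans ?_ ((MvPolynomial.le_totalDegree hd).trans hp)
    rw [Finset.card_eq_sum_ones, Finsupp.sum]
    exact Finset.sum_le_sum fun i hi =>
      Nat.one_le_iff_ne_zero.2 (Finsupp.mem_support_iff.1 hi)
  · rw [Submodule.span_le]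
    rintro _ ⟨S, rfl⟩
    exact monomialWord_mem_reedMuller S.2

/-- Every function on `𝔽₂ᵐ` is a polynomial function, so the `2 ^ m` square-free monomials span a
space of dimension `2 ^ m`. -/
theorem linearIndependent_monomialWord :
    LinearIndependent (ZMod 2) (monomialWord : Finset (Fin m) → _) := by
  refine linearIndependent_of_top_le_span_of_card_eq_finrank ?_ ?_
  · intro c _
    have hc : c ∈ (⊤ : Submodule (ZMod 2) ((Fin m → ZMod 2) → ZMod 2)) := trivial
    rw [← MvPolynomial.map_restrict_dom_evalₗ] at hc
    obtain ⟨p, -, rfl⟩ := hc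
    have : MvPolynomial.evalₗ (ZMod 2) (Fin m) p ∈ reedMuller p.totalDegree m :=
      mem_reedMuller.2 ⟨p, le_rfl, fun v => rfl⟩
    rw [reedMuller_eq_span] at this
    refine Submodule.span_mono ?_ this
    rintro _ ⟨S, rfl⟩
    exact ⟨S, rfl⟩
  · simp [ZMod.card]

theorem finrank_reedMuller (r : ℕ) :
    Module.finrank (ZMod 2) (reedMuller r m) =
      (Finset.univ.filter fun S : Finset (Fin m) => S.card ≤ r).card := by
  rw [reedMuller_eq_span, ← Fintype.card_subtype]
  exact finrank_span_eq_card (linearIndependent_monomialWord.comp _ Subtype.val_injective)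

/-- As in the Chevalley–Warning argument, a polynomial of degree below `m` sums to zero over `𝔽₂ᵐ`.
-/
theorem dotProduct_eq_zero_of_mem_reedMuller {r s : ℕ} (h : r + s < m)
    {c d : (Fin m → ZMod 2) → ZMod 2} (hc : c ∈ reedMuller r m) (hd : d ∈ reedMuller s m) :
    c ⬝ᵥ d = 0 := by
  obtain ⟨p, hp, hpc⟩ := mem_reedMuller.1 hc
  obtain ⟨q, hq, hqd⟩ := mem_reedMuller.1 hd
  have := MvPolynomial.sum_eval_eq_zero (p * q) (by
    refine (MvPolynomial.totalDegree_mul p q).trans_lt ?_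
    rw [ZMod.card, Fintype.card_fin]
    omega)
  simpa [dotProduct, hpc, hqd] using this

/-- Orthogonality gives one inclusion. The dimensions agree because complementation exchanges the
sets of size at most `s` with those of size greater than `r`. -/
theorem dual_reedMuller {r s : ℕ} (h : r + s + 1 = m) :
    dual (reedMuller r m) = reedMuller s m := by
  symm
  refine Submodule.eq_of_le_of_finrank_eq ?_ ?_
  · intro c hc
    exact mem_dual.2 fun d hd => dotProduct_eq_zero_of_mem_reedMuller (by omega) hc hd
  · have h1 := finrank_dual_add (reedMuller r m)
    have h2 : (Finset.univ.filter fun S : Finset (Fin m) => S.card ≤ s).card =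
        (Finset.univ.filter fun S : Finset (Fin m) => ¬ S.card ≤ r).card := by
      refine Finset.card_bij (fun S _ => Sᶜ) ?_ ?_ ?_
      · intro S hS
        simp only [Finset.mem_filter, Finset.mem_univ, true_and] at hS ⊢
        rw [Finset.card_compl, Fintype.card_fin]
        omega
      · intro S _ S' _ hSS
        exact compl_injective hSS
      · intro S hS
        simp only [Finset.mem_filter, Finset.mem_univ, true_and] at hS
        refine ⟨Sᶜ, ?_, compl_compl S⟩
        simp only [Finset.mem_filter, Finset.mem_univ, true_and]
        rw [Finset.card_compl, Fintype.card_fin]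
        omega
    have h3 := Finset.card_filter_add_card_filter_not (s := (Finset.univ : Finset (Finset (Fin m))))
      (fun S => S.card ≤ r)
    rw [finrank_reedMuller] at h1 ⊢
    rw [Finset.card_univ, Fintype.card_finset, Fintype.card_fin] at h3
    rw [Fintype.card_fun, ZMod.card, Fintype.card_fin] at h1
    omega

theorem finrank_reedMuller_two :
    Module.finrank (ZMod 2) (reedMuller 2 m) = 1 + m + m.choose 2 := by
  rw [finrank_reedMuller]
  have : (Finset.univ.filter fun S : Finset (Fin m) => S.card ≤ 2) =
      (Finset.range 3).biUnion fun j => Finset.powersetCard j Finset.univ := by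
    ext S
    simp [Finset.mem_powersetCard, Nat.lt_succ_iff]
  rw [this, Finset.card_biUnion]
  · simp [Finset.sum_range_succ, Finset.card_powersetCard]
  · intro i _ j _ hij
    exact Finset.pairwise_disjoint_powersetCard _ hij

theorem apply_eq_sum_single {A : Type*} [AddCommGroup A] [Module (ZMod 2) A]
    (f : (Fin m → ZMod 2) →ₗ[ZMod 2] A) (v : Fin m → ZMod 2) :
    f v = ∑ i, v i • f (Pi.single i 1) := by
  rw [LinearMap.pi_apply_eq_sum_univ f v]
  refine Finset.sum_congr rfl fun i _ => ?_
  congr 2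
  funext j
  simp [Pi.single_apply, eq_comm]

/-- Words of `RM(r, m)` with `r + 2 < m` are orthogonal to all products of two linear functions. -/
theorem sum_smul_mul_eq_zero {A : Type*} [CommRing A] [Algebra (ZMod 2) A] {r : ℕ} (h : r + 2 < m)
    {c : (Fin m → ZMod 2) → ZMod 2} (hc : c ∈ reedMuller r m)
    (f g : (Fin m → ZMod 2) →ₗ[ZMod 2] A) : ∑ v, c v • (f v * g v) = 0 := by
  have hij : ∀ i j : Fin m, ∑ v : Fin m → ZMod 2, c v * (v i * v j) = 0 := by
    intro i j
    refine dotProduct_eq_zero_of_mem_reedMuller h hc (d := fun v => v i * v j)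
      (mem_reedMuller.2 ⟨MvPolynomial.X i * MvPolynomial.X j, ?_, by simp⟩)
    refine (MvPolynomial.totalDegree_mul _ _).trans ?_
    simp
  calc ∑ v, c v • (f v * g v)
      = ∑ v, ∑ i, ∑ j, (c v * (v i * v j)) • (f (Pi.single i 1) * g (Pi.single j 1)) := by
        refine Finset.sum_congr rfl fun v _ => ?_
        rw [apply_eq_sum_single f v, apply_eq_sum_single g v, Finset.sum_mul_sum, Finset.smul_sum]
        refine Finset.sum_congr rfl fun i _ => ?_
        rw [Finset.smul_sum]
        refine Finset.sum_congr rfl fun j _ => ?_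
        rw [smul_mul_smul_comm, smul_smul]
    _ = ∑ i, ∑ j, (∑ v : Fin m → ZMod 2, c v * (v i * v j)) •
          (f (Pi.single i 1) * g (Pi.single j 1)) := by
        rw [Finset.sum_comm]
        refine Finset.sum_congr rfl fun i _ => ?_
        rw [Finset.sum_comm]
        refine Finset.sum_congr rfl fun j _ => ?_
        rw [Finset.sum_smul]
    _ = 0 := by simp [hij]

theorem sum_smul_eq_zero {A : Type*} [CommRing A] [Algebra (ZMod 2) A] {r : ℕ} (h : r + 2 < m)
    {c : (Fin m → ZMod 2) → ZMod 2} (hc : c ∈ reedMuller r m)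
    (f : (Fin m → ZMod 2) →ₗ[ZMod 2] A) : ∑ v, c v • f v = 0 := by
  have hi : ∀ i : Fin m, ∑ v : Fin m → ZMod 2, c v * v i = 0 := by
    intro i
    refine dotProduct_eq_zero_of_mem_reedMuller h hc (d := fun v => v i)
      (mem_reedMuller.2 ⟨MvPolynomial.X i, ?_, by simp⟩)
    simp
  have hexp : ∀ v, c v • f v = ∑ i, (c v * v i) • f (Pi.single i 1) := by
    intro v
    rw [apply_eq_sum_single f v, Finset.smul_sum]
    simp only [smul_smul]
  simp only [hexp]
  rw [Finset.sum_comm]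
  simp [← Finset.sum_smul, hi]

theorem sum_eq_zero_of_mem_reedMuller {r : ℕ} (h : r + 2 < m)
    {c : (Fin m → ZMod 2) → ZMod 2} (hc : c ∈ reedMuller r m) : ∑ v, c v = 0 := by
  have := dotProduct_eq_zero_of_mem_reedMuller h hc (d := fun _ => 1)
      (mem_reedMuller.2 ⟨1, by simp, by simp⟩)
  simpa [dotProduct] using this

theorem dotProduct_monomialWord_compl (S : Finset (Fin m)) :
    monomialWord S ⬝ᵥ monomialWord Sᶜ = 1 := by
  have : ∀ v, monomialWord S v * monomialWord Sᶜ v = ∏ i, v i := fun v =>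
    Finset.prod_mul_prod_compl S v
  simp only [dotProduct, this]
  rw [Finset.sum_eq_single 1]
  · simp
  · intro v _ hv
    obtain ⟨i, hi⟩ := Function.ne_iff.1 hv
    refine Finset.prod_eq_zero (Finset.mem_univ i) ?_
    generalize v i = x at hi
    revert x
    simp only [Pi.one_apply]
    decide
  · simp

theorem card_support_monomialWord (S : Finset (Fin m)) :
    (Finset.univ.filter fun v => monomialWord S v ≠ 0).card = 2 ^ (m - S.card) := by
  have : (Finset.univ.filter fun v => monomialWord S v ≠ 0) =
      Fintype.piFinset fun i => if i ∈ S then ({1} : Finset (ZMod 2)) else Finset.univ := by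
    ext v
    simp only [Finset.mem_filter, Finset.mem_univ, true_and, Fintype.mem_piFinset, monomialWord,
      Finset.prod_ne_zero_iff]
    refine forall_congr' fun i => ?_
    split_ifs with hi
    · simp only [hi, forall_const, Finset.mem_singleton]
      generalize v i = x
      revert x
      decide
    · simp [hi]
  rw [this, Fintype.card_piFinset]
  simp only [apply_ite Finset.card, Finset.card_singleton, Finset.card_univ, ZMod.card]
  rw [Finset.prod_ite, Finset.prod_const_one, Finset.prod_const, one_mul]
  congr 1
  rw [← Finset.compl_filter, Finset.card_compl, Fintype.card_fin]
  simp

end ReedMuller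

theorem zmod_two_eq_zero_or_one (z : ZMod 2) : z = 0 ∨ z = 1 := by revert z; decide

theorem zmod_two_ne_zero_iff {z : ZMod 2} : z ≠ 0 ↔ z = 1 := by revert z; decide

theorem zmod_two_univ : (Finset.univ : Finset (ZMod 2)) = {0, 1} := rfl

/-! ### Independence of power moments over a finite field of characteristic two -/

section Moments

variable {F : Type*} [Field F] [Fintype F]

/-- A linear combination of the functions `x ^ 2 ^ i`, `k ≤ i ≤ k + 3`, vanishes identically only
if the first two coefficients do. -/
theorem coeff_eq_zero_of_linearized {k : ℕ} (hk : 1 ≤ k) (hF : Fintype.card F = 2 ^ (2 * k + 3))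
    {b c c' b' : F}
    (h : ∀ x : F, b * x ^ 2 ^ k + c * x ^ 2 ^ (k + 1) + c' * x ^ 2 ^ (k + 2)
      + b' * x ^ 2 ^ (k + 3) = 0) : b = 0 ∧ c = 0 := by
  let p : Polynomial F := Polynomial.C b * Polynomial.X ^ 2 ^ k
    + Polynomial.C c * Polynomial.X ^ 2 ^ (k + 1) + Polynomial.C c' * Polynomial.X ^ 2 ^ (k + 2)
    + Polynomial.C b' * Polynomial.X ^ 2 ^ (k + 3)
  have hle : ∀ i ≤ k + 3, ∀ a : F,
      (Polynomial.C a * Polynomial.X ^ 2 ^ i).natDegree ≤ 2 ^ (k + 3) := fun i hi a =>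
    (Polynomial.natDegree_C_mul_X_pow_le _ _).trans (Nat.pow_le_pow_right (by norm_num) hi)
  have hdeg : p.natDegree ≤ 2 ^ (k + 3) :=
    Polynomial.natDegree_add_le_of_degree_le (Polynomial.natDegree_add_le_of_degree_le
      (Polynomial.natDegree_add_le_of_degree_le (hle _ (by omega) _) (hle _ (by omega) _))
      (hle _ (by omega) _)) (hle _ (by omega) _)
  have hp : p = 0 := by
    by_contra hp
    obtain ⟨x, hx⟩ := Polynomial.exists_eval_ne_zero_of_natDegree_lt_card p hp (by
      rw [Cardinal.mk_fintype, hF]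
      -- The assumption `1 ≤ k` gives `k + 3 < 2 * k + 3`: the degree is below the size of the
      -- field.
      exact_mod_cast hdeg.trans_lt (Nat.pow_lt_pow_right (by norm_num) (by omega)))
    exact hx (by simpa [p] using h x)
  have hne : ∀ i j : ℕ, (2 ^ i = 2 ^ j) ↔ i = j := fun i j =>
    Nat.pow_right_inj (by norm_num)
  constructor
  · have := congrArg (fun p => Polynomial.coeff p (2 ^ k)) hp
    simpa [p, Polynomial.coeff_X_pow, hne] using this
  · have := congrArg (fun p => Polynomial.coeff p (2 ^ (k + 1))) hp
    simpa [p, Polynomial.coeff_X_pow, hne] using this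

variable [Algebra (ZMod 2) F]

theorem trace_pow_two_pow (n : ℕ) (z : F) :
    Algebra.trace (ZMod 2) F (z ^ 2 ^ n) = Algebra.trace (ZMod 2) F z := by
  induction n with
  | zero => simp
  | succ n ih =>
    rw [← ih, pow_succ, pow_mul,
      ← Algebra.trace_eq_of_algEquiv (FiniteField.frobeniusAlgEquivOfAlgebraic (ZMod 2) F) (z ^ 2 ^ n)]
    simp

theorem exists_eq_trace_mul (l : F →ₗ[ZMod 2] ZMod 2) :
    ∃ b : F, ∀ x, l x = Algebra.trace (ZMod 2) F (b * x) := by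
  refine ⟨((Algebra.traceForm (ZMod 2) F).toDual (traceForm_nondegenerate (ZMod 2) F)).symm l,
    fun x => ?_⟩
  rw [← Algebra.traceForm_apply, LinearMap.BilinForm.apply_toDual_symm_apply]

theorem eq_zero_of_trace_mul {b : F} (h : ∀ x, Algebra.trace (ZMod 2) F (x * b) = 0) : b = 0 := by
  refine (traceForm_nondegenerate (ZMod 2) F).1 b fun x => ?_
  rw [Algebra.traceForm_apply, mul_comm, h]

/-- The cardinality modulo two and the power sums with exponents `1`, `2 ^ k + 1` and
`2 ^ (k + 1) + 1` of a subset of `F`, given by its indicator function. -/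
def powerMoments (F : Type*) [Field F] [Fintype F] [Algebra (ZMod 2) F] (k : ℕ) :
    (F → ZMod 2) →ₗ[ZMod 2] ZMod 2 × F × F × F :=
  Fintype.linearCombination (ZMod 2) fun y => (1, y, y ^ (2 ^ k + 1), y ^ (2 ^ (k + 1) + 1))

/-- A functional vanishing on the range gives an identity between an affine function and `Tr(b y ^
r) + Tr(c y ^ s)`. Polarization removes the affine part, and nondegeneracy of the trace form then
turns the identity into a linearized polynomial in one variable that vanishes on `F`. -/
theorem powerMoments_surjective {k : ℕ} (hk : 1 ≤ k) (hF : Fintype.card F = 2 ^ (2 * k + 3)) :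
    Function.Surjective (powerMoments F k) := by
  classical
  have : Fact (Nat.Prime 2) := ⟨Nat.prime_two⟩
  have : CharP F 2 := charP_of_injective_algebraMap (algebraMap (ZMod 2) F).injective 2
  rw [← LinearMap.range_eq_top]
  by_contra hne
  obtain ⟨l, hl0, hl⟩ := Submodule.exists_le_ker_of_lt_top _ (lt_top_iff_ne_top.2 hne)
  have hl' : ∀ y : F, l (1, y, y ^ (2 ^ k + 1), y ^ (2 ^ (k + 1) + 1)) = 0 := by
    intro y
    have := hl ⟨Pi.single y 1, rfl⟩
    simpa [powerMoments, Fintype.linearCombination_apply_single] using this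
  let l₀ : ZMod 2 →ₗ[ZMod 2] ZMod 2 := l ∘ₗ LinearMap.inl _ _ _
  let l₁ : F →ₗ[ZMod 2] ZMod 2 := l ∘ₗ LinearMap.inr _ _ _ ∘ₗ LinearMap.inl _ _ _
  let l₂ : F →ₗ[ZMod 2] ZMod 2 :=
    l ∘ₗ LinearMap.inr _ _ _ ∘ₗ LinearMap.inr _ _ _ ∘ₗ LinearMap.inl _ _ _
  let l₃ : F →ₗ[ZMod 2] ZMod 2 :=
    l ∘ₗ LinearMap.inr _ _ _ ∘ₗ LinearMap.inr _ _ _ ∘ₗ LinearMap.inr _ _ _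
  have hsplit : ∀ a b c d, l (a, b, c, d) = l₀ a + l₁ b + l₂ c + l₃ d := by
    intro a b c d
    simp only [l₀, l₁, l₂, l₃, LinearMap.comp_apply, LinearMap.inl_apply, LinearMap.inr_apply,
      ← map_add]
    simp
  obtain ⟨b, hb⟩ := exists_eq_trace_mul l₂
  obtain ⟨c, hc⟩ := exists_eq_trace_mul l₃
  simp only [hsplit] at hl'
  have hpow : ∀ z : F, z ^ 2 ^ (2 * k + 3) = z := fun z => by rw [← hF, FiniteField.pow_card]
  have pol : ∀ x y : F, l₂ (x ^ 2 ^ k * y + x * y ^ 2 ^ k)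
      + l₃ (x ^ 2 ^ (k + 1) * y + x * y ^ 2 ^ (k + 1)) = 0 := by
    intro x y
    have h0 := hl' 0
    have hx := hl' x
    have hy := hl' y
    have hxy := hl' (x + y)
    have e : ∀ n, (x + y) ^ (2 ^ n + 1) =
        x ^ (2 ^ n + 1) + y ^ (2 ^ n + 1) + (x ^ 2 ^ n * y + x * y ^ 2 ^ n) := by
      intro n
      rw [pow_succ, add_pow_char_pow]
      ring
    rw [e, e, map_add, map_add l₂, map_add l₃, map_add l₂, map_add l₃] at hxy
    simp only [ne_eq, Nat.add_eq_zero_iff, one_ne_zero, and_false, not_false_eq_true, zero_pow,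
      map_zero, add_zero] at h0
    linear_combination hxy - hx - hy + h0
  -- The trace is Frobenius-invariant, so the terms with `y ^ 2 ^ k` and `y ^ 2 ^ (k + 1)` can be
  -- raised to powers that make them linear in `y`. This produces the last two coefficients.
  have lin : ∀ x : F, b * x ^ 2 ^ k + c * x ^ 2 ^ (k + 1) + c ^ 2 ^ (k + 2) * x ^ 2 ^ (k + 2)
      + b ^ 2 ^ (k + 3) * x ^ 2 ^ (k + 3) = 0 := by
    intro x
    refine eq_zero_of_trace_mul fun y => ?_
    have h := pol x y
    rw [hb, hc, mul_add, mul_add, map_add, map_add, ← trace_pow_two_pow (k + 3) (b * (x * y ^ _)),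
      ← trace_pow_two_pow (k + 2) (c * (x * y ^ _)), mul_pow, mul_pow, mul_pow, mul_pow, ← pow_mul,
      ← pow_mul, ← pow_add, ← pow_add, show k + (k + 3) = 2 * k + 3 by ring,
      show k + 1 + (k + 2) = 2 * k + 3 by ring, hpow] at h
    rw [← h, ← map_add, ← map_add, ← map_add]
    congr 1
    ring
  obtain ⟨rfl, rfl⟩ := coeff_eq_zero_of_linearized hk hF lin
  have h2 : l₂ = 0 := LinearMap.ext fun x => by rw [hb, zero_mul, map_zero]; rfl
  have h3 : l₃ = 0 := LinearMap.ext fun x => by rw [hc, zero_mul, map_zero]; rfl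
  simp only [h2, h3, LinearMap.zero_apply, add_zero] at hl' hsplit
  have h0 : l₀ 1 = 0 := by simpa using hl' 0
  have h1 : ∀ y, l₁ y = 0 := fun y => by simpa [h0] using hl' y
  refine hl0 (LinearMap.ext fun ⟨a, b, c, d⟩ => ?_)
  rw [hsplit, h1, ← mul_one a, ← smul_eq_mul, map_smul, h0]
  simp

end Moments

/-! ### Goethals codes -/

section Goethals

variable {m : ℕ} {F : Type*} [Field F] [Fintype F]

/-- The sum of the values of a function at the points of one half of a word. -/
def halfSum {A : Type*} [AddCommGroup A] [Module (ZMod 2) A]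
    (e : (Fin m → ZMod 2) ≃+ F × ZMod 2) (φ : F → A) (ε : ZMod 2) :
    ((Fin m → ZMod 2) → ZMod 2) →ₗ[ZMod 2] A :=
  Fintype.linearCombination (ZMod 2) φ ∘ₗ LinearMap.funLeft (ZMod 2) (ZMod 2) fun x => e.symm (x, ε)

variable (e : (Fin m → ZMod 2) ≃+ F × ZMod 2)

section
variable {A : Type*} [AddCommGroup A] [Module (ZMod 2) A] (φ : F → A) (ε : ZMod 2)
  (c : (Fin m → ZMod 2) → ZMod 2)

theorem halfSum_apply : halfSum e φ ε c = ∑ x, c (e.symm (x, ε)) • φ x := rfl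

theorem halfSum_eq_sum_half : halfSum e φ ε c = ∑ x ∈ half e c ε, φ x := by
  rw [halfSum_apply, half, Finset.sum_filter]
  refine Finset.sum_congr rfl fun x _ => ?_
  generalize c (e.symm (x, ε)) = z
  rcases zmod_two_eq_zero_or_one z with rfl | rfl <;> simp

theorem halfSum_add_halfSum : halfSum e φ 0 c + halfSum e φ 1 c = ∑ v, c v • φ (e v).1 := by
  rw [← Equiv.sum_comp e.symm.toEquiv, Fintype.sum_prod_type_right]
  rw [zmod_two_univ, Finset.sum_pair zero_ne_one, halfSum_apply, halfSum_apply]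
  simp

theorem halfSum_one : halfSum e φ 1 c = ∑ v, c v • (e v).2 • φ (e v).1 := by
  rw [← Equiv.sum_comp e.symm.toEquiv, Fintype.sum_prod_type_right]
  rw [zmod_two_univ, Finset.sum_pair zero_ne_one, halfSum_apply]
  simp

end

theorem even_card_half_iff (ε : ZMod 2) (c : (Fin m → ZMod 2) → ZMod 2) :
    Even (half e c ε).card ↔ halfSum e (fun _ => (1 : ZMod 2)) ε c = 0 := by
  rw [halfSum_eq_sum_half, Finset.sum_const, nsmul_eq_mul, mul_one, ZMod.natCast_eq_zero_iff_even]

variable [Algebra (ZMod 2) F]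

/-- The moments which determine membership in the Goethals code. -/
def goethalsMoments (k : ℕ) : ((Fin m → ZMod 2) → ZMod 2) →ₗ[ZMod 2]
    (ZMod 2 × F) × (ZMod 2 × F × F × F) :=
  ((halfSum e (fun _ => 1) 0).prod (halfSum e (fun x => x) 0)).prod
    ((halfSum e (fun _ => 1) 1).prod ((halfSum e (fun x => x) 1).prod
      ((halfSum e (fun x => x ^ (2 ^ k + 1)) 0 + halfSum e (fun x => x ^ (2 ^ k + 1)) 1).prod
        (halfSum e (fun x => x ^ (2 ^ (k + 1) + 1)) 0
          + halfSum e (fun x => x ^ (2 ^ (k + 1) + 1)) 1))))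

/-- The moments of a Goethals codeword, in terms of the sum of the points of each half. -/
def goethalsTarget (k : ℕ) (S : F) : (ZMod 2 × F) × (ZMod 2 × F × F × F) :=
  ((0, S), (0, S, S ^ (2 ^ k + 1), S ^ (2 ^ (k + 1) + 1)))

/-- All nonlinearity is moved into `goethalsTarget`, which leaves a linear map on words. -/
theorem mem_goethals_iff {k : ℕ} (hm : m = 2 * k + 4) {c : (Fin m → ZMod 2) → ZMod 2} :
    c ∈ goethals e ↔ goethalsMoments e k c = goethalsTarget k (halfSum e (fun x => x) 0 c) := by
  have : CharP F 2 := charP_of_injective_algebraMap (algebraMap (ZMod 2) F).injective 2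
  have hr : m / 2 - 2 = k := by omega
  have hs : m / 2 - 1 = k + 1 := by omega
  have h2 : ∀ a b d : F, a + b = d ↔ a + d = b := by
    intro a b d
    constructor <;> rintro rfl <;> rw [← add_assoc, CharTwo.add_self_eq_zero, zero_add]
  simp only [goethals, Set.mem_ofPred_eq, hr, hs, even_card_half_iff, ← halfSum_eq_sum_half e,
    goethalsMoments, goethalsTarget, LinearMap.prod_apply, Function.prod, Prod.mk.injEq,
    LinearMap.add_apply, h2]
  tauto

theorem goethalsMoments_surjective {k : ℕ} (hk : 1 ≤ k) (hF : Fintype.card F = 2 ^ (2 * k + 3)) :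
    Function.Surjective (goethalsMoments e k) := by
  rintro ⟨⟨a, b⟩, a', b', ρ, κ⟩
  obtain ⟨X, hX⟩ := powerMoments_surjective hk hF (a, b, 0, 0)
  obtain ⟨Y, hY⟩ := powerMoments_surjective hk hF (a', b', ρ, κ)
  refine ⟨fun v => if (e v).2 = 0 then X (e v).1 else Y (e v).1, ?_⟩
  simp only [powerMoments, Fintype.linearCombination_apply, Prod.ext_iff, Prod.fst_sum,
    Prod.snd_sum, Prod.smul_fst, Prod.smul_snd] at hX hY
  obtain ⟨x0, x1, x2, x3⟩ := hX
  obtain ⟨y0, y1, y2, y3⟩ := hY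
  simp [goethalsMoments, halfSum_apply, ← x0, ← x1, x2, x3, ← y0, ← y1, ← y2, ← y3]

/-- Restricting to a half multiplies by the last coordinate, which raises the degree by one; a power
`x ^ (2 ^ n + 1)` is already quadratic and enters only through the sum over both halves. -/
theorem goethalsMoments_eq_zero {k r : ℕ} (hr : r + 2 < m) {c : (Fin m → ZMod 2) → ZMod 2}
    (hc : c ∈ reedMuller r m) : goethalsMoments e k c = 0 := by
  have : Fact (Nat.Prime 2) := ⟨Nat.prime_two⟩
  have : CharP F 2 := charP_of_injective_algebraMap (algebraMap (ZMod 2) F).injective 2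
  let f : (Fin m → ZMod 2) →ₗ[ZMod 2] F :=
    (((AddMonoidHom.fst F (ZMod 2)).comp e.toAddMonoidHom).toZModLinearMap 2)
  let g : (Fin m → ZMod 2) →ₗ[ZMod 2] ZMod 2 :=
    (((AddMonoidHom.snd F (ZMod 2)).comp e.toAddMonoidHom).toZModLinearMap 2)
  have hone : halfSum e (fun _ => (1 : ZMod 2)) 1 c = 0 := by
    rw [halfSum_one]
    simpa [g] using sum_smul_eq_zero hr hc g
  have hzero : halfSum e (fun _ => (1 : ZMod 2)) 0 c = 0 := by
    have h := halfSum_add_halfSum e (fun _ => (1 : ZMod 2)) c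
    rw [hone, add_zero] at h
    rw [h]
    simpa using sum_eq_zero_of_mem_reedMuller hr hc
  have hone' : halfSum e (fun x => x) 1 c = 0 := by
    rw [halfSum_one, ← sum_smul_mul_eq_zero hr hc ((Algebra.linearMap (ZMod 2) F) ∘ₗ g) f]
    refine Finset.sum_congr rfl fun v _ => ?_
    rw [Algebra.smul_def (e v).2]
    rfl
  have hzero' : halfSum e (fun x => x) 0 c = 0 := by
    have h := halfSum_add_halfSum e (fun x => x) c
    rw [hone', add_zero] at h
    rw [h]
    exact sum_smul_eq_zero hr hc f
  have hpow : ∀ n, halfSum e (fun x => x ^ (2 ^ n + 1)) 0 c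
      + halfSum e (fun x => x ^ (2 ^ n + 1)) 1 c = 0 := by
    intro n
    rw [halfSum_add_halfSum, ← sum_smul_mul_eq_zero hr hc
      (((iterateFrobenius F 2 n).toAddMonoidHom.toZModLinearMap 2) ∘ₗ f) f]
    refine Finset.sum_congr rfl fun v _ => ?_
    rw [pow_succ]
    rfl
  simp [goethalsMoments, hone, hzero, hone', hzero', hpow]

theorem add_mem_goethals {k r : ℕ} (hm : m = 2 * k + 4) (hr : r + 2 < m)
    {c g : (Fin m → ZMod 2) → ZMod 2} (hc : c ∈ reedMuller r m) (hg : g ∈ goethals e) :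
    c + g ∈ goethals e := by
  have h0 := goethalsMoments_eq_zero e (k := k) hr hc
  have h1 : halfSum e (fun x => x) 0 c = 0 := congrArg (fun p => p.1.2) h0
  rw [mem_goethals_iff e hm] at hg ⊢
  rw [map_add, map_add, h0, h1, zero_add, zero_add, hg]

theorem zero_mem_goethals {k : ℕ} (hm : m = 2 * k + 4) : 0 ∈ goethals e := by
  rw [mem_goethals_iff e hm]
  simp [goethalsTarget, Prod.ext_iff]

theorem exists_mem_goethals {k : ℕ} (hm : m = 2 * k + 4) (hk : 1 ≤ k)
    (hF : Fintype.card F = 2 ^ (2 * k + 3)) (S : F) :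
    ∃ g ∈ goethals e, halfSum e (fun x => x) 0 g = S := by
  obtain ⟨g, hg⟩ := goethalsMoments_surjective e hk hF (goethalsTarget k S)
  have hS : halfSum e (fun x => x) 0 g = S := congrArg (fun p => p.1.2) hg
  exact ⟨g, (mem_goethals_iff e hm).2 (by rw [hS, hg]), hS⟩

/-- The Goethals code is not linear. -/
theorem exists_add_notMem_goethals {k : ℕ} (hm : m = 2 * k + 4) (hk : 1 ≤ k)
    (hF : Fintype.card F = 2 ^ (2 * k + 3)) :
    ∃ g ∈ goethals e, ∃ g' ∈ goethals e, g + g' ∉ goethals e := by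
  have : Fact (Nat.Prime 2) := ⟨Nat.prime_two⟩
  have : CharP F 2 := charP_of_injective_algebraMap (algebraMap (ZMod 2) F).injective 2
  by_contra! hcon
  -- Codewords with half sums `1` and `x` have a codeword as sum only if `S ↦ S ^ r` and `S ↦ S ^ s`
  -- are additive at this pair.
  have hfix : ∀ x : F, x ^ 2 ^ k + x = 0 ∧ x ^ 2 ^ (k + 1) + x = 0 := by
    intro x
    obtain ⟨g, hg, hgS⟩ := exists_mem_goethals e hm hk hF 1
    obtain ⟨g', hg', hgS'⟩ := exists_mem_goethals e hm hk hF x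
    have h := hcon g hg g' hg'
    rw [mem_goethals_iff e hm] at hg hg' h
    rw [map_add, map_add, hg, hg', hgS, hgS'] at h
    have aux : ∀ n, (1 : F) ^ (2 ^ n + 1) + x ^ (2 ^ n + 1) = (1 + x) ^ (2 ^ n + 1) →
        x ^ 2 ^ n + x = 0 := by
      intro n hn
      rw [pow_succ (1 + x), add_pow_char_pow, one_pow, one_pow] at hn
      linear_combination -hn
    exact ⟨aux k (congrArg (fun p => p.2.2.2.1) h), aux (k + 1) (congrArg (fun p => p.2.2.2.2) h)⟩
  have hfix2 : ∀ x : F, (1 : F) * x ^ 2 ^ k + (-1) * x ^ 2 ^ (k + 1) + 0 * x ^ 2 ^ (k + 2)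
      + 0 * x ^ 2 ^ (k + 3) = 0 := by
    intro x
    linear_combination (hfix x).1 - (hfix x).2
  exact one_ne_zero (coeff_eq_zero_of_linearized hk hF hfix2).1

/-- The minimum distance of the Goethals code. -/
theorem eq_of_mem_goethals {k : ℕ} (hm : m = 2 * k + 4)
    (hF : Fintype.card F = 2 ^ (2 * k + 3)) {c c' : (Fin m → ZMod 2) → ZMod 2}
    (hc : c ∈ goethals e) (hc' : c' ∈ goethals e)
    (hd : (Finset.univ.filter fun v => (c - c') v ≠ 0).card < 8) : c = c' := by
  classical
  have : Fact (Nat.Prime 2) := ⟨Nat.prime_two⟩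
  have : CharP F 2 := charP_of_injective_algebraMap (algebraMap (ZMod 2) F).injective 2
  have hpow : ∀ z : F, z ^ 2 ^ (2 * k + 3) = z := fun z => by rw [← hF, FiniteField.pow_card]
  rw [mem_goethals_iff e hm] at hc hc'
  set A := halfSum e (fun x => x) 0 c with hA
  set B := halfSum e (fun x => x) 0 c' with hB
  have hM : goethalsMoments e k (c - c') = goethalsTarget k A - goethalsTarget k B := by
    rw [map_sub, hc, hc']
  simp only [goethalsMoments, goethalsTarget, LinearMap.prod_apply, Function.prod, Prod.mk_sub_mk,
    Prod.mk.injEq, LinearMap.add_apply, sub_self] at hM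
  obtain ⟨⟨u0, u1⟩, v0, v1, hr, hs⟩ := hM
  rw [← even_card_half_iff] at u0 v0
  rw [halfSum_eq_sum_half] at u1 v1
  rw [halfSum_eq_sum_half, halfSum_eq_sum_half] at hr hs
  set U := half e (c - c') 0 with hU
  set V := half e (c - c') 1 with hV
  have hcard : U.card + V.card < 8 := by
    refine lt_of_le_of_lt (le_of_eq ?_) hd
    rw [hU, hV, half, half]
    simp only [Finset.card_filter, zmod_two_ne_zero_iff]
    rw [← Equiv.sum_comp e.symm.toEquiv, Fintype.sum_prod_type_right]
    rw [zmod_two_univ, Finset.sum_pair zero_ne_one]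
    rfl
  have hinj : Function.Injective fun x : F => 1 * (x + A) := fun x y h => by simpa using h
  have hsum : ∑ x ∈ U.image (fun x : F => 1 * (x + A)), x = A - B := by
    have h0 : (U.card : F) = 0 := (CharP.cast_eq_zero_iff F 2 _).2 u0.two_dvd
    rw [Finset.sum_image fun x _ y _ h => hinj h, ← Finset.mul_sum, Finset.sum_add_distrib, u1]
    simp [h0]
  -- Translating `U` by `A` absorbs the cross terms of `A ^ (2 ^ n + 1) - B ^ (2 ^ n + 1)`, so that
  -- `(U + A, V)` satisfies the Goethals equations.
  have htr : ∀ n, ∑ x ∈ U, x ^ (2 ^ n + 1) + ∑ y ∈ V, y ^ (2 ^ n + 1)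
      = A ^ (2 ^ n + 1) - B ^ (2 ^ n + 1) →
      ∑ x ∈ U.image (fun x : F => 1 * (x + A)), x ^ (2 ^ n + 1) +
        (∑ x ∈ U.image (fun x : F => 1 * (x + A)), x) ^ (2 ^ n + 1) =
        ∑ y ∈ V, y ^ (2 ^ n + 1) := by
    intro n h
    rw [hsum, Finset.sum_image fun x _ y _ h => hinj h, sum_affine_pow n U u0, u1,
      pow_succ (A - B), sub_pow_char_pow]
    linear_combination h + (- ∑ y ∈ V, y ^ (2 ^ n + 1) + A ^ (2 ^ n + 1) * 2 - A * B ^ 2 ^ n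
      - A ^ 2 ^ n * B) * CharTwo.two_eq_zero (R := F)
  obtain ⟨hU0, hV0⟩ := goethals_pair_eq_empty hpow (U.image fun x : F => 1 * (x + A)) V
    (by rwa [Finset.card_image_of_injective _ hinj]) v0
    (by rwa [Finset.card_image_of_injective _ hinj]) (by rw [hsum, v1]) (htr k hr) (htr (k + 1) hs)
  rw [Finset.image_eq_empty] at hU0
  have hz : ∀ x ε, (c - c') (e.symm (x, ε)) = 0 := by
    intro x ε
    have hne : (c - c') (e.symm (x, ε)) ≠ 1 := by
      intro h1
      have hx : x ∈ half e (c - c') ε := by simpa [half] using h1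
      rcases zmod_two_eq_zero_or_one ε with rfl | rfl
      · rw [← hU, hU0] at hx; simp at hx
      · rw [← hV, hV0] at hx; simp at hx
    exact (zmod_two_eq_zero_or_one _).resolve_right hne
  refine sub_eq_zero.1 (funext fun v => ?_)
  have := hz (e v).1 (e v).2
  simpa using this

end Goethals

/-! ### Counting cosets -/

section Cosets

theorem card_preimage_mul_card {A B : Type*} [AddCommGroup A] [Fintype A] [AddCommGroup B]
    [Fintype B] [DecidableEq B] (f : A →+ B) (hf : Function.Surjective f) (s : Finset B) :
    (Finset.univ.filter fun a => f a ∈ s).card * Fintype.card B = s.card * Fintype.card A := by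
  have key : ∀ s : Finset B, (Finset.univ.filter fun a => f a ∈ s).card =
      s.card * (Finset.univ.filter fun a => f a = 0).card := by
    intro s
    rw [Finset.card_eq_sum_card_fiberwise (f := f) (t := s) (fun a ha => by simpa using ha)]
    refine Finset.sum_const_nat fun b hb => ?_
    rw [← AddMonoidHom.card_fiber_eq_of_mem_range f (hf b) (hf 0), Finset.filter_filter]
    congr 1
    ext a
    simp only [Finset.mem_filter, Finset.mem_univ, true_and, and_iff_right_iff_imp]
    rintro rfl
    exact hb
  have huniv := key Finset.univ
  simp only [Finset.mem_univ, Finset.filter_true, Finset.card_univ] at huniv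
  rw [key s, huniv]
  ring

variable {ι : Type*} {R : Submodule (ZMod 2) (ι → ZMod 2)} {G : Set (ι → ZMod 2)}

theorem IsCosetDecomposition.mem_iff {T : Finset (ι → ZMod 2)} (h : IsCosetDecomposition R G T)
    {v : ι → ZMod 2} : v ∈ G ↔ ∃ t ∈ T, v - t ∈ R := by
  rw [h.1]
  simp only [Set.mem_iUnion, Set.mem_ofPred_eq, exists_prop]
  refine exists_congr fun t => and_congr_right fun _ => ?_
  constructor
  · rintro ⟨c, hc, rfl⟩
    simpa using hc
  · exact fun hv => ⟨v - t, hv, by simp⟩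

theorem IsCosetDecomposition.card {T : Finset (ι → ZMod 2)} (h : IsCosetDecomposition R G T) :
    Nat.card G = T.card * Nat.card R := by
  let f : T × R → G := fun p => ⟨p.2.1 + p.1.1, h.mem_iff.2 ⟨p.1.1, p.1.2, by simp⟩⟩
  have hf : Function.Bijective f := by
    constructor
    · rintro ⟨t, c⟩ ⟨t', c'⟩ heq
      have heq' : c.1 + t.1 = c'.1 + t'.1 := congrArg Subtype.val heq
      have htt : t = t' := Subtype.ext (h.2 _ t.2 _ t'.2 (by
        have : t.1 - t'.1 = c'.1 - c.1 := by
          rw [sub_eq_sub_iff_add_eq_add, add_comm, heq']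
        rw [this]
        exact R.sub_mem c'.2 c.2))
      subst htt
      exact Prod.ext rfl (Subtype.ext (add_right_cancel heq'))
    · rintro ⟨v, hv⟩
      obtain ⟨t, ht, hvt⟩ := h.mem_iff.1 hv
      exact ⟨(⟨t, ht⟩, ⟨v - t, hvt⟩), Subtype.ext (by simp [f])⟩
  rw [← Nat.card_congr (Equiv.ofBijective f hf), Nat.card_prod, Nat.card_eq_fintype_card,
    Fintype.card_coe]

theorem exists_isCosetDecomposition [Finite ι] (h : ∀ c ∈ R, ∀ g ∈ G, c + g ∈ G) :
    ∃ T, IsCosetDecomposition R G T := by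
  classical
  let σ : (ι → ZMod 2) → (ι → ZMod 2) := fun g => (Submodule.Quotient.mk (p := R) g).out
  have hσ : ∀ g, g - σ g ∈ R := fun g =>
    (Submodule.Quotient.eq R).1 (Quotient.out_eq (Submodule.Quotient.mk (p := R) g)).symm
  have hmem : ∀ t, t ∈ (Set.toFinite G).toFinset.image σ ↔ ∃ g ∈ G, σ g = t := by simp
  refine ⟨(Set.toFinite G).toFinset.image σ, ?_, ?_⟩
  · ext v
    simp only [Set.mem_iUnion, Set.mem_ofPred_eq, exists_prop]
    constructor
    · intro hv
      exact ⟨σ v, (hmem _).2 ⟨v, hv, rfl⟩, v - σ v, hσ v, by simp⟩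
    · rintro ⟨t, ht, c, hc, rfl⟩
      obtain ⟨g, hg, rfl⟩ := (hmem t).1 ht
      have := h (c - (g - σ g)) (R.sub_mem hc (hσ g)) g hg
      rwa [show c - (g - σ g) + g = c + σ g by abel] at this
  · intro t ht t' ht' htt
    obtain ⟨g, hg, rfl⟩ := (hmem t).1 ht
    obtain ⟨g', hg', rfl⟩ := (hmem t').1 ht'
    have hgg : g - g' ∈ R := by
      have := R.sub_mem (R.add_mem (hσ g) htt) (hσ g')
      convert this using 1
      abel
    simp only [σ]
    rw [(Submodule.Quotient.eq R).2 hgg]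

end Cosets

/-! ### The action of Pauli operators -/

section Pauli

variable {ι : Type*} [Fintype ι]

/-- The sign character of `𝔽₂`. -/
def sgn (z : ZMod 2) : ℂ := if z = 0 then 1 else -1

@[simp] theorem sgn_zero : sgn 0 = 1 := if_pos rfl

theorem sgn_one : sgn 1 = -1 := if_neg one_ne_zero

theorem sgn_add (z w : ZMod 2) : sgn (z + w) = sgn z * sgn w := by
  have h : (1 : ZMod 2) + 1 = 0 := by decide
  rcases zmod_two_eq_zero_or_one z with rfl | rfl <;>
    rcases zmod_two_eq_zero_or_one w with rfl | rfl <;> simp [h, sgn_one]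

theorem sgn_mul_self (z : ZMod 2) : sgn z * sgn z = 1 := by
  rcases zmod_two_eq_zero_or_one z with rfl | rfl <;> simp [sgn_one]

theorem conj_sgn (z : ZMod 2) : (starRingEnd ℂ) (sgn z) = sgn z := by
  rcases zmod_two_eq_zero_or_one z with rfl | rfl <;> simp [sgn_one]

theorem sgn_sum {α : Type*} (s : Finset α) (f : α → ZMod 2) :
    sgn (∑ i ∈ s, f i) = ∏ i ∈ s, sgn (f i) := by
  classical
  induction s using Finset.induction_on with
  | empty => simp
  | insert a s ha ih => rw [Finset.sum_insert ha, Finset.prod_insert ha, sgn_add, ih]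

theorem word_add_self {α : Type*} (a : α → ZMod 2) : a + a = 0 :=
  funext fun i => CharTwo.add_self_eq_zero (a i)

theorem word_eq_add_iff {α : Type*} {x y a : α → ZMod 2} : x = y + a ↔ y = x + a := by
  constructor <;> rintro rfl <;> rw [add_assoc, word_add_self, add_zero]

theorem sigma_apply (α β x y : ZMod 2) :
    (sigmaX ^ α.val * sigmaZ ^ β.val) x y = if x = y + α then sgn (β * y) else 0 := by
  have h : (1 : ZMod 2) + 1 = 0 := by decide
  have hv : (1 : ZMod 2).val = 1 := rfl
  rcases zmod_two_eq_zero_or_one α with rfl | rfl <;>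
    rcases zmod_two_eq_zero_or_one β with rfl | rfl <;>
    rcases zmod_two_eq_zero_or_one x with rfl | rfl <;>
    rcases zmod_two_eq_zero_or_one y with rfl | rfl <;>
    simp [hv, h, sigmaX, sigmaZ, sgn_one, Matrix.mul_diagonal]

theorem pauli_apply (a b x y : ι → ZMod 2) :
    pauli a b x y = if x = y + a then sgn (b ⬝ᵥ y) else 0 := by
  simp only [pauli, Matrix.of_apply, sigma_apply]
  rw [Finset.prod_ite_zero, dotProduct, sgn_sum]
  simp [funext_iff]

theorem pauli_zero_zero : pauli (0 : ι → ZMod 2) 0 = 1 := by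
  ext x y
  rw [pauli_apply, Matrix.one_apply]
  simp

variable [DecidableEq ι]

theorem pauli_mul (a b a' b' : ι → ZMod 2) :
    pauli a b * pauli a' b' = sgn (b ⬝ᵥ a') • pauli (a + a') (b + b') := by
  ext x y
  simp only [Matrix.mul_apply, pauli_apply, Matrix.smul_apply, smul_eq_mul, mul_ite, mul_zero]
  rw [Finset.sum_ite_eq' Finset.univ (y + a') fun z => (if x = z + a then sgn (b ⬝ᵥ z) else 0) * _,
    if_pos (Finset.mem_univ _), add_assoc y, add_comm a' a]
  split_ifs
  · rw [dotProduct_add, sgn_add, add_dotProduct, sgn_add]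
    ring
  · simp

theorem toEuclideanLin_mul_apply (A B : Matrix (ι → ZMod 2) (ι → ZMod 2) ℂ) (ψ : Qubits ι) :
    Matrix.toEuclideanLin (A * B) ψ = Matrix.toEuclideanLin A (Matrix.toEuclideanLin B ψ) := by
  simp [Matrix.toLpLin_apply]

theorem pauliOp_apply (a b : ι → ZMod 2) (ψ : Qubits ι) (x : ι → ZMod 2) :
    pauliOp a b ψ x = sgn (b ⬝ᵥ (x + a)) * ψ (x + a) := by
  simp only [pauliOp, Matrix.toLpLin_apply, Matrix.mulVec, dotProduct, pauli_apply, ite_mul,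
    zero_mul, word_eq_add_iff (x := x)]
  rw [Finset.sum_ite_eq' Finset.univ (x + a), if_pos (Finset.mem_univ _)]

theorem pauliOp_zero_zero (ψ : Qubits ι) : pauliOp 0 0 ψ = ψ := by
  ext x
  simp [pauliOp_apply]

theorem pauliOp_pauliOp (a b a' b' : ι → ZMod 2) (ψ : Qubits ι) :
    pauliOp a b (pauliOp a' b' ψ) = sgn (b ⬝ᵥ a') • pauliOp (a + a') (b + b') ψ := by
  rw [pauliOp, pauliOp, ← toEuclideanLin_mul_apply, pauli_mul, map_smul]
  rfl

theorem pauliOp_comm (a b a' b' : ι → ZMod 2) (ψ : Qubits ι) :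
    pauliOp a b (pauliOp a' b' ψ) =
      (sgn (b ⬝ᵥ a') * sgn (b' ⬝ᵥ a)) • pauliOp a' b' (pauliOp a b ψ) := by
  rw [pauliOp_pauliOp, pauliOp_pauliOp, smul_smul, mul_assoc, sgn_mul_self, mul_one, add_comm a,
    add_comm b]

theorem pauliOp_self (a b : ι → ZMod 2) (ψ : Qubits ι) :
    pauliOp a b (pauliOp a b ψ) = sgn (b ⬝ᵥ a) • ψ := by
  rw [pauliOp_pauliOp, word_add_self, word_add_self, pauliOp_zero_zero]

theorem pauliOp_injective (a b : ι → ZMod 2) :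
    Function.Injective (pauliOp a b) := by
  intro φ ψ h
  have h' := congrArg (fun χ => sgn (b ⬝ᵥ a) • pauliOp a b χ) h
  simpa [pauliOp_self, smul_smul, sgn_mul_self] using h'

theorem inner_pauliOp_pauliOp (a b : ι → ZMod 2) (φ ψ : Qubits ι) :
    inner ℂ (pauliOp a b φ) (pauliOp a b ψ) = inner ℂ φ ψ := by
  rw [PiLp.inner_apply, PiLp.inner_apply, ← Equiv.sum_comp (Equiv.addRight a) fun x =>
    inner ℂ (φ x) (ψ x)]
  refine Finset.sum_congr rfl fun x _ => ?_
  simp only [pauliOp_apply, RCLike.inner_apply, map_mul, conj_sgn, Equiv.coe_addRight]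
  linear_combination ψ (x + a) * (starRingEnd ℂ) (φ (x + a)) * sgn_mul_self (b ⬝ᵥ (x + a))

end Pauli

/-! ### Joint eigenspaces of the stabilizer of a CSS code -/

section Syndrome

variable {ι : Type*} [Fintype ι] [DecidableEq ι]

/-- The joint eigenspace of the operators `(a|0)`, `(0|b)`, `a, b ∈ R^⊥`, on which they act with
the same signs as on the translate of the CSS code of `R` by `t`. -/
def syndromeSpace (R : Submodule (ZMod 2) (ι → ZMod 2)) (t : (ι → ZMod 2) × (ι → ZMod 2)) :
    Submodule ℂ (Qubits ι) where
  carrier := {ψ | ∀ a ∈ dual R,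
    pauliOp a 0 ψ = sgn (t.2 ⬝ᵥ a) • ψ ∧ pauliOp 0 a ψ = sgn (t.1 ⬝ᵥ a) • ψ}
  zero_mem' := by simp
  add_mem' := by
    intro φ ψ hφ hψ a ha
    rw [map_add, map_add, (hφ a ha).1, (hφ a ha).2, (hψ a ha).1, (hψ a ha).2, smul_add, smul_add]
    exact ⟨rfl, rfl⟩
  smul_mem' := by
    intro c ψ hψ a ha
    rw [map_smul, map_smul, (hψ a ha).1, (hψ a ha).2, smul_comm c, smul_comm c]
    exact ⟨rfl, rfl⟩

variable {R : Submodule (ZMod 2) (ι → ZMod 2)}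

theorem mem_syndromeSpace {t : (ι → ZMod 2) × (ι → ZMod 2)} {ψ : Qubits ι} :
    ψ ∈ syndromeSpace R t ↔ ∀ a ∈ dual R,
      pauliOp a 0 ψ = sgn (t.2 ⬝ᵥ a) • ψ ∧ pauliOp 0 a ψ = sgn (t.1 ⬝ᵥ a) • ψ := Iff.rfl

theorem mem_cssCode {ψ : Qubits ι} :
    ψ ∈ cssCode R R ↔ ∀ a ∈ dual R, pauliOp a 0 ψ = ψ ∧ pauliOp 0 a ψ = ψ := by
  simp [cssCode, Submodule.mem_iInf, forall_and]

theorem syndromeSpace_zero : syndromeSpace R 0 = cssCode R R := by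
  ext ψ
  rw [mem_syndromeSpace, mem_cssCode]
  simp

/-- Commuting `(a|b)` past a stabilizer element costs the sign of their symplectic product. -/
theorem pauliOp_mem_syndromeSpace {t : (ι → ZMod 2) × (ι → ZMod 2)} {ψ : Qubits ι}
    (hψ : ψ ∈ syndromeSpace R t) (a b : ι → ZMod 2) :
    pauliOp a b ψ ∈ syndromeSpace R (t + (a, b)) := by
  intro d hd
  obtain ⟨h1, h2⟩ := hψ d hd
  rw [pauliOp_comm, pauliOp_comm 0 d, h1, h2, map_smul, map_smul, smul_smul, smul_smul]
  simp only [zero_dotProduct, dotProduct_zero, sgn_zero, Prod.fst_add, Prod.snd_add,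
    add_dotProduct, sgn_add, one_mul, mul_one, dotProduct_comm d a]
  rw [mul_comm (sgn (b ⬝ᵥ d)), mul_comm (sgn (a ⬝ᵥ d))]
  exact ⟨rfl, rfl⟩

theorem translate_cssCode (t : (ι → ZMod 2) × (ι → ZMod 2)) :
    translate (cssCode R R) t = syndromeSpace R t := by
  refine le_antisymm ?_ ?_
  · rintro _ ⟨ψ, hψ, rfl⟩
    rw [SetLike.mem_coe, ← syndromeSpace_zero] at hψ
    simpa using pauliOp_mem_syndromeSpace hψ t.1 t.2
  · intro ψ hψ
    refine ⟨sgn (t.2 ⬝ᵥ t.1) • pauliOp t.1 t.2 ψ, ?_, ?_⟩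
    · rw [SetLike.mem_coe, ← syndromeSpace_zero]
      refine Submodule.smul_mem _ _ ?_
      have h := pauliOp_mem_syndromeSpace hψ t.1 t.2
      have h0 : t + (t.1, t.2) = 0 := Prod.ext (word_add_self _) (word_add_self _)
      rwa [h0] at h
    · rw [map_smul, pauliOp_self, smul_smul, sgn_mul_self, one_smul]

theorem syndromeSpace_le {t t' : (ι → ZMod 2) × (ι → ZMod 2)} (h1 : t.1 - t'.1 ∈ R)
    (h2 : t.2 - t'.2 ∈ R) : syndromeSpace R t ≤ syndromeSpace R t' := by
  intro ψ hψ a ha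
  have aux : ∀ u u' : ι → ZMod 2, u - u' ∈ R → u ⬝ᵥ a = u' ⬝ᵥ a := by
    intro u u' h
    rw [← sub_eq_zero, ← sub_dotProduct, dotProduct_comm]
    exact ha _ h
  rw [← aux _ _ h1, ← aux _ _ h2]
  exact hψ a ha

theorem inner_eq_zero_of_eigen {a b : ι → ZMod 2} {z w : ZMod 2} (hzw : z ≠ w) {φ ψ : Qubits ι}
    (hφ : pauliOp a b φ = sgn z • φ) (hψ : pauliOp a b ψ = sgn w • ψ) : inner ℂ φ ψ = 0 := by
  have h := inner_pauliOp_pauliOp a b φ ψ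
  rw [hφ, hψ, inner_smul_left, inner_smul_right, conj_sgn, ← mul_assoc, ← sgn_add,
    zmod_two_ne_zero_iff.1 (show z + w ≠ 0 from fun h0 => hzw (CharTwo.add_eq_zero.1 h0)),
    sgn_one] at h
  linear_combination -h / 2

/-- Since `R = R^⊥⊥`, some element of `R^⊥` separates the two cosets. The corresponding unitary
stabilizer element has different eigenvalues on the two spaces. -/
theorem syndromeSpace_isOrtho {t t' : (ι → ZMod 2) × (ι → ZMod 2)}
    (h : ¬ (t.1 - t'.1 ∈ R ∧ t.2 - t'.2 ∈ R)) : syndromeSpace R t ⟂ syndromeSpace R t' := by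
  have aux : ∀ u u' : ι → ZMod 2, u - u' ∉ R → ∃ a ∈ dual R, u ⬝ᵥ a ≠ u' ⬝ᵥ a := by
    intro u u' hu
    rw [← dual_dual R, mem_dual] at hu
    push Not at hu
    obtain ⟨a, ha, hne⟩ := hu
    exact ⟨a, ha, fun h0 => hne (by rw [sub_dotProduct, h0, sub_self])⟩
  rw [Submodule.isOrtho_iff_inner_eq]
  intro φ hφ ψ hψ
  rw [not_and_or] at h
  rcases h with h | h
  · obtain ⟨a, ha, hne⟩ := aux _ _ h
    exact inner_eq_zero_of_eigen hne (hφ a ha).2 (hψ a ha).2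
  · obtain ⟨a, ha, hne⟩ := aux _ _ h
    exact inner_eq_zero_of_eigen hne (hφ a ha).1 (hψ a ha).1

theorem finrank_syndromeSpace (t : (ι → ZMod 2) × (ι → ZMod 2)) :
    Module.finrank ℂ (syndromeSpace R t) = Module.finrank ℂ (cssCode R R) := by
  rw [← translate_cssCode, translate]
  exact (LinearEquiv.finrank_eq
    (Submodule.equivMapOfInjective _ (pauliOp_injective t.1 t.2) (cssCode R R))).symm

theorem unionCode_cssCode (T : Finset ((ι → ZMod 2) × (ι → ZMod 2))) :
    unionCode (cssCode R R) T = ⨆ t ∈ T, syndromeSpace R t := by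
  simp only [unionCode, translate_cssCode]

end Syndrome

/-! ### CSS codes -/

section CSS

variable {ι : Type*} [Fintype ι] {R : Submodule (ZMod 2) (ι → ZMod 2)}

open scoped Classical in
/-- The encoding of functions on `R / R^⊥`. -/
def cosetEncoding (R : Submodule (ZMod 2) (ι → ZMod 2)) :
    ((R ⧸ (dual R).comap R.subtype) → ℂ) →ₗ[ℂ] Qubits ι where
  toFun g := WithLp.toLp 2 fun x =>
    if h : x ∈ R then g (Submodule.Quotient.mk ⟨x, h⟩) else 0
  map_add' g g' := by
    ext x
    by_cases h : x ∈ R <;> simp [h]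
  map_smul' c g := by
    ext x
    by_cases h : x ∈ R <;> simp [h]

theorem cosetEncoding_apply (g : (R ⧸ (dual R).comap R.subtype) → ℂ) (x : R) :
    cosetEncoding R g x = g (Submodule.Quotient.mk x) := by
  simp [cosetEncoding]

theorem cosetEncoding_injective : Function.Injective (cosetEncoding R) := by
  intro g g' h
  funext q
  obtain ⟨x, rfl⟩ := Submodule.Quotient.mk_surjective _ q
  rw [← cosetEncoding_apply g x, h, cosetEncoding_apply]

open scoped Classical in
/-- The uniform superposition of the words of `R^⊥`. -/
def dualState (R : Submodule (ZMod 2) (ι → ZMod 2)) : Qubits ι :=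
  WithLp.toLp 2 fun x => if x ∈ dual R then 1 else 0

theorem dualState_apply_of_mem {x : ι → ZMod 2} (h : x ∈ dual R) : dualState R x = 1 := by
  simp [dualState, h]

theorem dualState_apply_of_notMem {x : ι → ZMod 2} (h : x ∉ dual R) : dualState R x = 0 := by
  simp [dualState, h]

theorem dualState_ne_zero : dualState R ≠ 0 := by
  intro h
  have := congrArg (fun ψ : Qubits ι => ψ 0) h
  simp [dualState_apply_of_mem (dual R).zero_mem] at this

variable [DecidableEq ι]

/-- The bit flips impose invariance under `R^⊥`; the phase flips impose support in `R^⊥⊥ = R`. The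
code thus consists of functions on `R / R^⊥`, which gives its dimension. -/
theorem mem_cssCode_iff_apply {ψ : Qubits ι} :
    ψ ∈ cssCode R R ↔ (∀ a ∈ dual R, ∀ x, ψ (x + a) = ψ x) ∧ ∀ x, x ∉ R → ψ x = 0 := by
  simp only [mem_cssCode, forall₂_and]
  refine and_congr ?_ ?_
  · refine forall₂_congr fun a _ => ?_
    rw [PiLp.ext_iff]
    simp [pauliOp_apply]
  · constructor
    · intro h x hx
      rw [← dual_dual R, mem_dual] at hx
      push Not at hx
      obtain ⟨b, hb, hne⟩ := hx
      have hx := congrArg (fun χ : Qubits ι => χ x) (h b hb)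
      simp only [pauliOp_apply, add_zero] at hx
      rw [dotProduct_comm, zmod_two_ne_zero_iff.1 hne, sgn_one] at hx
      linear_combination -hx / 2
    · intro h b hb
      ext x
      rw [pauliOp_apply, add_zero]
      by_cases hx : x ∈ R
      · rw [hb x hx, sgn_zero, one_mul]
      · rw [h x hx, mul_zero]

theorem range_cosetEncoding (hR : dual R ≤ R) :
    LinearMap.range (cosetEncoding R) = cssCode R R := by
  ext ψ
  rw [mem_cssCode_iff_apply]
  constructor
  · rintro ⟨g, rfl⟩
    refine ⟨fun a ha x => ?_, fun x hx => by simp [cosetEncoding, hx]⟩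
    by_cases hx : x ∈ R
    · have h1 := cosetEncoding_apply g ⟨x, hx⟩
      have h2 := cosetEncoding_apply g ⟨x + a, R.add_mem hx (hR ha)⟩
      rw [h1, h2]
      congr 1
      rw [Submodule.Quotient.eq]
      simpa using ha
    · have hx' : x + a ∉ R := fun h => hx (by simpa using R.sub_mem h (hR ha))
      simp [cosetEncoding, hx, hx']
  · rintro ⟨h1, h2⟩
    refine ⟨fun q => ψ q.out.1, ?_⟩
    ext x
    by_cases hx : x ∈ R
    · rw [cosetEncoding_apply _ ⟨x, hx⟩]
      set y := (Submodule.Quotient.mk (p := (dual R).comap R.subtype) ⟨x, hx⟩).out with hy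
      have hxy : y - ⟨x, hx⟩ ∈ (dual R).comap R.subtype :=
        (Submodule.Quotient.eq _).1 (Quotient.out_eq _)
      have := h1 _ hxy x
      rw [← this]
      simp
    · rw [h2 x hx]
      simp [cosetEncoding, hx]

theorem finrank_cssCode (hR : dual R ≤ R) : Module.finrank ℂ (cssCode R R) =
    2 ^ (Module.finrank (ZMod 2) R - Module.finrank (ZMod 2) (dual R)) := by
  classical
  have := Fintype.ofFinite (R ⧸ (dual R).comap R.subtype)
  rw [← range_cosetEncoding hR, LinearMap.finrank_range_of_inj cosetEncoding_injective,
    Module.finrank_fintype_fun_eq_card]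
  rw [Module.card_eq_pow_finrank (K := ZMod 2), ZMod.card, Submodule.finrank_quotient,
    (Submodule.comapSubtypeEquivOfLe hR).finrank_eq]

theorem dualState_mem_cssCode (hR : dual R ≤ R) : dualState R ∈ cssCode R R := by
  refine mem_cssCode_iff_apply.2
    ⟨fun a ha x => ?_, fun x hx => dualState_apply_of_notMem fun h => hx (hR h)⟩
  by_cases hx : x ∈ dual R
  · rw [dualState_apply_of_mem hx, dualState_apply_of_mem ((dual R).add_mem hx ha)]
  · rw [dualState_apply_of_notMem hx, dualState_apply_of_notMem fun h =>
      hx (by simpa using (dual R).sub_mem h ha)]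

/-- The CSS code of `R` does not detect the bit flips in `R` outside `R^⊥`. -/
theorem not_detects_cssCode (hR : dual R ≤ R) {a : ι → ZMod 2} (ha : a ∈ R) (ha' : a ∉ dual R) :
    ¬ Detects (cssCode R R) a 0 := by
  rintro ⟨c, hc⟩
  have h0 := dualState_mem_cssCode hR
  have h1 : pauliOp a 0 (dualState R) ∈ cssCode R R := by
    rw [← syndromeSpace_zero] at h0 ⊢
    refine syndromeSpace_le ?_ ?_ (pauliOp_mem_syndromeSpace h0 a 0)
    · simpa using ha
    · simp
  have h := hc _ h1 _ h0
  have hz : inner ℂ (pauliOp a 0 (dualState R)) (dualState R) = (0 : ℂ) := by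
    rw [PiLp.inner_apply]
    refine Finset.sum_eq_zero fun x _ => ?_
    by_cases hx : x ∈ dual R
    · rw [pauliOp_apply, dualState_apply_of_notMem (x := x + a), mul_zero, inner_zero_left]
      exact fun h => ha' (by simpa using (dual R).sub_mem h hx)
    · rw [dualState_apply_of_notMem hx, inner_zero_right]
  rw [hz, mul_zero, inner_pauliOp_pauliOp, inner_self_eq_zero] at h
  exact dualState_ne_zero h

theorem isStabilizerCode_cssCode (hR : dual R ≤ R) : IsStabilizerCode (cssCode R R) := by
  have hmul : ∀ a b a' b' : ι → ZMod 2, b ∈ dual R → a' ∈ dual R →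
      pauli a b * pauli a' b' = pauli (a + a') (b + b') := by
    intro a b a' b' hb ha'
    rw [pauli_mul, hb a' (hR ha'), sgn_zero, one_smul]
  have hsq : ∀ a b : ι → ZMod 2, a ∈ dual R → b ∈ dual R → pauli a b * pauli a b = 1 := by
    intro a b ha hb
    rw [hmul a b a b hb ha, word_add_self, word_add_self, pauli_zero_zero]
  let S : Subgroup (Matrix (ι → ZMod 2) (ι → ZMod 2) ℂ)ˣ :=
    { carrier := {g | ∃ a ∈ dual R, ∃ b ∈ dual R, g.val = pauli a b}
      one_mem' := ⟨0, (dual R).zero_mem, 0, (dual R).zero_mem, pauli_zero_zero.symm⟩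
      mul_mem' := by
        rintro g h ⟨a, ha, b, hb, hg⟩ ⟨a', ha', b', hb', hh⟩
        refine ⟨a + a', (dual R).add_mem ha ha', b + b', (dual R).add_mem hb hb', ?_⟩
        rw [Units.val_mul, hg, hh, hmul _ _ _ _ hb ha']
      inv_mem' := by
        rintro g ⟨a, ha, b, hb, hg⟩
        refine ⟨a, ha, b, hb, ?_⟩
        have : g⁻¹ = g := inv_eq_of_mul_eq_one_left (Units.ext (by
          rw [Units.val_mul, hg, hsq a b ha hb, Units.val_one]))
        rw [this, hg] }
  refine ⟨S, ?_, ?_, ?_, ?_⟩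
  · rintro g ⟨a, -, b, -, hg⟩
    exact ⟨0, a, b, by rw [hg, pow_zero, one_smul]⟩
  · rintro g ⟨a, ha, b, hb, hg⟩ h ⟨a', ha', b', hb', hh⟩
    refine Units.ext ?_
    rw [Units.val_mul, Units.val_mul, hg, hh, hmul _ _ _ _ hb ha', hmul _ _ _ _ hb' ha,
      add_comm a, add_comm b]
  · rintro g ⟨a, ha, b, hb, hg⟩ c hc
    -- The entry in row `a`, column `0` of `pauli a b` is `1`, while for a scalar matrix it is zero
    -- unless `a = 0`.
    have h := congrFun (congrFun (hg.symm.trans hc) a) 0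
    rw [pauli_apply, zero_add, if_pos rfl, dotProduct_zero, sgn_zero, Matrix.smul_apply,
      Matrix.one_apply, smul_eq_mul] at h
    split_ifs at h
    · simpa using h.symm
    · simp at h
  · intro ψ
    rw [mem_cssCode]
    constructor
    · rintro h g ⟨a, ha, b, hb, hg⟩
      have hab := pauliOp_pauliOp a 0 0 b ψ
      rw [(h b hb).2, (h a ha).1, zero_dotProduct, sgn_zero, one_smul, add_zero, zero_add] at hab
      rw [hg]
      exact hab.symm
    · intro h a ha
      have h0 := (dual R).zero_mem
      exact ⟨h ⟨pauli a 0, pauli a 0, hsq a 0 ha h0, hsq a 0 ha h0⟩ ⟨a, ha, 0, h0, rfl⟩,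
        h ⟨pauli 0 a, pauli 0 a, hsq 0 a h0 ha, hsq 0 a h0 ha⟩ ⟨0, h0, a, ha, rfl⟩⟩

end CSS

/-! ### Union codes -/

section Union

variable {ι : Type*} [Fintype ι]

theorem card_support_le_pauliWeight_left (a b : ι → ZMod 2) :
    (Finset.univ.filter fun i => a i ≠ 0).card ≤ pauliWeight a b :=
  Finset.card_le_card fun i hi => by
    simp only [Finset.mem_filter, Finset.mem_univ, true_and] at hi ⊢
    exact Or.inl hi

theorem card_support_le_pauliWeight_right (a b : ι → ZMod 2) :
    (Finset.univ.filter fun i => b i ≠ 0).card ≤ pauliWeight a b :=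
  Finset.card_le_card fun i hi => by
    simp only [Finset.mem_filter, Finset.mem_univ, true_and] at hi ⊢
    exact Or.inr hi

variable [DecidableEq ι] {R : Submodule (ZMod 2) (ι → ZMod 2)}

theorem finrank_biSup_of_isOrtho {E α : Type*} [NormedAddCommGroup E] [InnerProductSpace ℂ E]
    [FiniteDimensional ℂ E] (V : α → Submodule ℂ E) (T : Finset α)
    (h : ∀ t ∈ T, ∀ t' ∈ T, t ≠ t' → V t ⟂ V t') :
    Module.finrank ℂ (⨆ t ∈ T, V t : Submodule ℂ E) = ∑ t ∈ T, Module.finrank ℂ (V t) := by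
  classical
  induction T using Finset.induction_on with
  | empty => simp
  | insert a s ha ih =>
    rw [Finset.iSup_insert, Finset.sum_insert ha, ← ih fun t ht t' ht' =>
      h t (Finset.mem_insert_of_mem ht) t' (Finset.mem_insert_of_mem ht')]
    have hort : V a ⟂ ⨆ t ∈ s, V t := by
      simp only [Submodule.isOrtho_iSup_right]
      intro t ht
      exact h a (Finset.mem_insert_self a s) t (Finset.mem_insert_of_mem ht)
        (fun hat => ha (hat ▸ ht))
    rw [← Submodule.finrank_sup_add_finrank_inf_eq, hort.disjoint.eq_bot, finrank_bot, add_zero]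

theorem Detects.mono {Q Q' : Submodule ℂ (Qubits ι)} (h : Q ≤ Q') {a b : ι → ZMod 2}
    (hd : Detects Q' a b) : Detects Q a b := by
  obtain ⟨c, hc⟩ := hd
  exact ⟨c, fun φ hφ ψ hψ => hc φ (h hφ) ψ (h hψ)⟩

theorem detects_zero (Q : Submodule ℂ (Qubits ι)) : Detects Q 0 0 :=
  ⟨1, fun φ _ ψ _ => by rw [pauliOp_zero_zero, one_mul]⟩

/-- An error which moves every translate to a translate orthogonal to the code is detected. -/
theorem detects_of_forall_notMem {T : Finset ((ι → ZMod 2) × (ι → ZMod 2))} {a b : ι → ZMod 2}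
    (h : ∀ t ∈ T, ∀ t' ∈ T, ¬ (t.1 - (t'.1 + a) ∈ R ∧ t.2 - (t'.2 + b) ∈ R)) :
    Detects (unionCode (cssCode R R) T) a b := by
  have hort : (⨆ t ∈ T, syndromeSpace R t) ⟂ (⨆ t ∈ T, syndromeSpace R t).map (pauliOp a b) := by
    simp only [Submodule.map_iSup, Submodule.isOrtho_iSup_left, Submodule.isOrtho_iSup_right]
    intro t' ht' t ht
    refine (syndromeSpace_isOrtho (t' := t' + (a, b)) (h t ht t' ht')).mono_right ?_
    rintro _ ⟨ψ, hψ, rfl⟩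
    exact pauliOp_mem_syndromeSpace hψ a b
  refine ⟨0, fun φ hφ ψ hψ => ?_⟩
  rw [unionCode_cssCode] at hφ hψ
  rw [zero_mul]
  exact Submodule.isOrtho_iff_inner_eq.1 hort φ hφ _ ⟨ψ, hψ, rfl⟩

/-- The minimum distance of a CSS-like union code whose classical code has minimum distance at
least `d`, in the presence of a word of weight `d` in `R` outside `R^⊥`. -/
theorem hasMinDistance_cssUnionCode (hR : dual R ≤ R) {G : Set (ι → ZMod 2)} {d : ℕ}
    (hG : ∀ c ∈ G, ∀ c' ∈ G, (Finset.univ.filter fun i => (c - c') i ≠ 0).card < d → c = c')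
    (hRG : ∀ c ∈ R, c ∈ G) {T₁ T₂ : Finset (ι → ZMod 2)} (h₁ : IsCosetDecomposition R G T₁)
    (h₂ : IsCosetDecomposition R G T₂) {a : ι → ZMod 2} (ha : a ∈ R) (ha' : a ∉ dual R)
    (had : (Finset.univ.filter fun i => a i ≠ 0).card = d) :
    HasMinDistance (cssUnionCode R R T₁ T₂) d := by
  have h0 := hRG 0 R.zero_mem
  constructor
  · refine ⟨a, 0, fun hdet => not_detects_cssCode hR ha ha' (hdet.mono ?_), ?_⟩
    · obtain ⟨t₁, ht₁, h1⟩ := h₁.mem_iff.1 h0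
      obtain ⟨t₂, ht₂, h2⟩ := h₂.mem_iff.1 h0
      rw [cssUnionCode, unionCode_cssCode, ← syndromeSpace_zero]
      exact (syndromeSpace_le (t' := (t₁, t₂)) h1 h2).trans
        (le_iSup₂_of_le (t₁, t₂) (Finset.mk_mem_product ht₁ ht₂) le_rfl)
    · rw [← had, pauliWeight]
      simp
  · rintro w ⟨a, b, hdet, rfl⟩
    by_contra! hlt
    refine hdet ?_
    -- If `u` moves one coset into another, then `t'` and `t' + u` are both in `G`, at distance the
    -- weight of `u`.
    have key : ∀ {T : Finset (ι → ZMod 2)}, IsCosetDecomposition R G T → ∀ t ∈ T, ∀ t' ∈ T,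
        ∀ u : ι → ZMod 2, (Finset.univ.filter fun i => u i ≠ 0).card < d →
        t - (t' + u) ∈ R → u = 0 := by
      intro T hT t ht t' ht' u hu htu
      have ht'G : t' ∈ G := hT.mem_iff.2 ⟨t', ht', by simp⟩
      have huG : t' + u ∈ G := hT.mem_iff.2 ⟨t, ht, by rw [← neg_sub]; exact R.neg_mem htu⟩
      have := hG _ huG _ ht'G (by simpa using hu)
      simpa using this
    by_cases hab : a = 0 ∧ b = 0
    · rw [hab.1, hab.2]
      exact detects_zero _
    · refine detects_of_forall_notMem fun t ht t' ht' hmem => hab ?_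
      rw [Finset.mem_product] at ht ht'
      exact ⟨key h₁ _ ht.1 _ ht'.1 a ((card_support_le_pauliWeight_left a b).trans_lt hlt) hmem.1,
        key h₂ _ ht.2 _ ht'.2 b ((card_support_le_pauliWeight_right a b).trans_lt hlt) hmem.2⟩

theorem translate_isOrtho {G : Set (ι → ZMod 2)} {T₁ T₂ : Finset (ι → ZMod 2)}
    (h₁ : IsCosetDecomposition R G T₁) (h₂ : IsCosetDecomposition R G T₂) :
    ∀ t ∈ T₁ ×ˢ T₂, ∀ t' ∈ T₁ ×ˢ T₂, t ≠ t' →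
      translate (cssCode R R) t ⟂ translate (cssCode R R) t' := by
  intro t ht t' ht' hne
  rw [Finset.mem_product] at ht ht'
  rw [translate_cssCode, translate_cssCode]
  exact syndromeSpace_isOrtho fun h =>
    hne (Prod.ext (h₁.2 _ ht.1 _ ht'.1 h.1) (h₂.2 _ ht.2 _ ht'.2 h.2))

theorem finrank_cssUnionCode {G : Set (ι → ZMod 2)} {T₁ T₂ : Finset (ι → ZMod 2)}
    (h₁ : IsCosetDecomposition R G T₁) (h₂ : IsCosetDecomposition R G T₂) :
    Module.finrank ℂ (cssUnionCode R R T₁ T₂) =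
      T₁.card * T₂.card * Module.finrank ℂ (cssCode R R) := by
  rw [cssUnionCode, unionCode, finrank_biSup_of_isOrtho _ _ (translate_isOrtho h₁ h₂)]
  have : ∀ t, Module.finrank ℂ (translate (cssCode R R) t) = Module.finrank ℂ (cssCode R R) :=
    fun t => by rw [translate_cssCode, finrank_syndromeSpace]
  rw [Finset.sum_congr rfl fun t _ => this t, Finset.sum_const, Finset.card_product, smul_eq_mul]

/-- A CSS-like union code of a nonlinear code is not additive. -/
theorem not_isStabilizerCode_cssUnionCode (hR : dual R ≤ R) {G : Set (ι → ZMod 2)}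
    (h0 : 0 ∈ G) {g g' : ι → ZMod 2} (hg : g ∈ G) (hg' : g' ∈ G) (hgg : g + g' ∉ G)
    {T₁ T₂ : Finset (ι → ZMod 2)}
    (h₁ : IsCosetDecomposition R G T₁) (h₂ : IsCosetDecomposition R G T₂) :
    ¬ IsStabilizerCode (cssUnionCode R R T₁ T₂) := by
  rintro ⟨S, hpauli, -, -, hS⟩
  have hψ := dualState_mem_cssCode hR
  set ψ := dualState R
  have hne : ψ ≠ 0 := dualState_ne_zero
  rw [← syndromeSpace_zero] at hψ
  have hmem : ∀ t ∈ G, pauliOp t 0 ψ ∈ cssUnionCode R R T₁ T₂ := by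
    intro t ht
    obtain ⟨t₁, ht₁, h1⟩ := h₁.mem_iff.1 ht
    obtain ⟨t₂, ht₂, h2⟩ := h₂.mem_iff.1 h0
    rw [cssUnionCode, unionCode_cssCode]
    refine Submodule.mem_iSup_of_mem (t₁, t₂) (Submodule.mem_iSup_of_mem
      (Finset.mk_mem_product ht₁ ht₂) (syndromeSpace_le ?_ ?_ (pauliOp_mem_syndromeSpace hψ t 0)))
    · simpa using h1
    · simpa using h2
  -- As `s` fixes `ψ`, it acts on a flipped `ψ` only by the commutation sign, which is additive in
  -- `t`. Hence fixing the flips by `g` and `g'` implies fixing the flip by `g + g'`.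
  have hcomm : ∀ s ∈ S, ∃ b : ι → ZMod 2, ∀ t, Matrix.toEuclideanLin s.val (pauliOp t 0 ψ) =
      sgn (b ⬝ᵥ t) • pauliOp t 0 ψ := by
    intro s hs
    obtain ⟨k, a, b, hk⟩ := hpauli s hs
    refine ⟨b, fun t => ?_⟩
    have hfix := (hS _).1 (hmem 0 h0) s hs
    rw [pauliOp_zero_zero] at hfix
    have hop : ∀ χ, Matrix.toEuclideanLin s.val χ = Complex.I ^ k • pauliOp a b χ := by
      intro χ
      rw [hk, map_smul]
      rfl
    rw [hop, pauliOp_comm, smul_comm, ← map_smul, ← hop, hfix]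
    simp
  have hsum : pauliOp (g + g') 0 ψ ∈ cssUnionCode R R T₁ T₂ := by
    refine (hS _).2 fun s hs => ?_
    obtain ⟨b, hb⟩ := hcomm s hs
    have hone : ∀ t ∈ G, sgn (b ⬝ᵥ t) = 1 := by
      intro t ht
      have hfix := (hS _).1 (hmem t ht) s hs
      rw [hb] at hfix
      have hne' : pauliOp t 0 ψ ≠ 0 := fun h => hne (pauliOp_injective t 0 (by rw [h, map_zero]))
      exact smul_left_injective ℂ hne' (by simpa using hfix)
    rw [hb, dotProduct_add, sgn_add, hone g hg, hone g' hg', mul_one, one_smul]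
  have hort : syndromeSpace R ((0, 0) + (g + g', 0)) ⟂ cssUnionCode R R T₁ T₂ := by
    rw [cssUnionCode, unionCode_cssCode]
    simp only [Submodule.isOrtho_iSup_right]
    intro t ht
    refine syndromeSpace_isOrtho fun h => hgg (h₁.mem_iff.2 ⟨t.1, (Finset.mem_product.1 ht).1, ?_⟩)
    simpa using h.1
  have hz := Submodule.isOrtho_iff_inner_eq.1 hort _ (pauliOp_mem_syndromeSpace hψ _ _) _ hsum
  rw [inner_self_eq_zero] at hz
  exact hne (pauliOp_injective _ _ (by rw [hz, map_zero]))

end Union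

/-! ### Parameters of the Goethals code -/

section Parameters

variable {m : ℕ}

/-- Ensures that the subtraction in the exponent of the number of cosets is not truncated. -/
theorem choose_two_ge (hm : 6 ≤ m) : 2 * m ≤ m.choose 2 := by
  rw [Nat.choose_two_right, Nat.le_div_iff_mul_le (by norm_num)]
  have : 5 ≤ m - 1 := by omega
  nlinarith

theorem dual_reedMuller_sub_three (hm : 6 ≤ m) : dual (reedMuller (m - 3) m) = reedMuller 2 m :=
  dual_reedMuller (by omega)

theorem dual_reedMuller_le (hm : 6 ≤ m) : dual (reedMuller (m - 3) m) ≤ reedMuller (m - 3) m := by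
  rw [dual_reedMuller_sub_three hm]
  intro c hc
  obtain ⟨p, hp, hpc⟩ := mem_reedMuller.1 hc
  exact mem_reedMuller.2 ⟨p, by omega, hpc⟩

theorem finrank_reedMuller_sub_three (hm : 6 ≤ m) :
    Module.finrank (ZMod 2) (reedMuller (m - 3) m) + (1 + m + m.choose 2) = 2 ^ m := by
  have h := finrank_dual_add (reedMuller (m - 3) m)
  rw [dual_reedMuller_sub_three hm, finrank_reedMuller_two, Fintype.card_fun, ZMod.card,
    Fintype.card_fin] at h
  omega

theorem finrank_reedMuller_ge (hm : 6 ≤ m) :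
    1 + m + m.choose 2 ≤ Module.finrank (ZMod 2) (reedMuller (m - 3) m) := by
  rw [← finrank_reedMuller_two, ← dual_reedMuller_sub_three hm]
  exact Submodule.finrank_mono (dual_reedMuller_le hm)

/-- `RM(m - 3, m)` contains a word of weight eight outside its dual. -/
theorem exists_weight_eight (hm : 6 ≤ m) : ∃ a ∈ reedMuller (m - 3) m,
    a ∉ dual (reedMuller (m - 3) m) ∧ (Finset.univ.filter fun v => a v ≠ 0).card = 8 := by
  -- A monomial of degree `m - 3` has a support of size `2 ^ 3`. The complementary monomial has
  -- degree `3 ≤ m - 3`, so it lies in `R` and witnesses non-orthogonality.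
  obtain ⟨S, -, hS⟩ := Finset.exists_subset_card_eq
    (show m - 3 ≤ (Finset.univ : Finset (Fin m)).card by simp)
  refine ⟨monomialWord S, monomialWord_mem_reedMuller hS.le, fun h => ?_, ?_⟩
  · have h0 := h (monomialWord Sᶜ) (monomialWord_mem_reedMuller (by
      rw [Finset.card_compl, Fintype.card_fin]; omega))
    rw [dotProduct_monomialWord_compl] at h0
    exact one_ne_zero h0
  · rw [card_support_monomialWord, hS, show m - (m - 3) = 3 by omega]
    norm_num

variable {F : Type*} [Field F] [Fintype F] [Algebra (ZMod 2) F]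
  (e : (Fin m → ZMod 2) ≃+ F × ZMod 2)

/-- The code is the union of the fibres over `|F|` targets in a space made of four copies of `F` and
two of `𝔽₂`. -/
theorem card_goethals {k : ℕ} (hm : m = 2 * k + 4) (hk : 1 ≤ k)
    (hF : Fintype.card F = 2 ^ (2 * k + 3)) :
    Nat.card (goethals e) * 2 ^ (4 * (2 * k + 3) + 2) = 2 ^ (2 * k + 3 + 2 ^ m) := by
  classical
  have hinj : Function.Injective (goethalsTarget k : F → _) := fun S S' h =>
    congrArg (fun p => p.1.2) h
  have h := card_preimage_mul_card (goethalsMoments e k).toAddMonoidHom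
    (goethalsMoments_surjective e hk hF) (Finset.univ.image (goethalsTarget k))
  have hset : (Finset.univ.filter fun c => (goethalsMoments e k).toAddMonoidHom c ∈
      Finset.univ.image (goethalsTarget (F := F) k)) =
      Finset.univ.filter fun c => c ∈ goethals e := by
    ext c
    simp only [Finset.mem_filter, Finset.mem_univ, true_and, Finset.mem_image,
      mem_goethals_iff e hm, LinearMap.toAddMonoidHom_coe]
    constructor
    · rintro ⟨S, hS⟩
      have : S = halfSum e (fun x => x) 0 c := congrArg (fun p => p.1.2) hS
      rw [← this, hS]
    · exact fun h => ⟨_, h.symm⟩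
  rw [hset, Finset.card_image_of_injective _ hinj, Finset.card_univ, hF,
    ← Fintype.card_subtype] at h
  rw [Nat.card_eq_fintype_card]
  simp only [Fintype.card_prod, Fintype.card_fun, ZMod.card, hF, Fintype.card_fin] at h
  rw [pow_add 2 (2 * k + 3), ← h, pow_add 2 (4 * _), mul_comm 4, pow_mul]
  generalize 2 ^ (2 * k + 3) = q
  ring

theorem card_cosets {k : ℕ} (hm : m = 2 * k + 4) (hk : 1 ≤ k)
    (hF : Fintype.card F = 2 ^ (2 * k + 3)) {T : Finset ((Fin m → ZMod 2) → ZMod 2)}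
    (hT : IsCosetDecomposition (reedMuller (m - 3) m) (goethals e) T) :
    T.card = 2 ^ (m.choose 2 - 2 * m + 2) := by
  have hm6 : 6 ≤ m := by omega
  have h := card_goethals e hm hk hF
  have h1 := finrank_reedMuller_sub_three hm6
  have h2 := choose_two_ge hm6
  rw [hT.card, Module.natCard_eq_pow_finrank (K := ZMod 2), Nat.card_zmod, mul_assoc, ← pow_add] at h
  generalize 2 ^ m = n at h h1
  have hexp : 2 * k + 3 + n = m.choose 2 - 2 * m + 2 +
      (Module.finrank (ZMod 2) (reedMuller (m - 3) m) + (4 * (2 * k + 3) + 2)) := by omega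
  rw [hexp, pow_add 2 (m.choose 2 - 2 * m + 2)] at h
  exact Nat.eq_of_mul_eq_mul_right (Nat.pow_pos (by norm_num)) h

end Parameters

end QCode

end

theorem mainTheorem3 (m : ℕ) (hm : 6 ≤ m) (hme : Even m)
    (F : Type*) [Field F] [Fintype F] (hF : Fintype.card F = 2 ^ (m - 1))
    (e : (Fin m → ZMod 2) ≃+ F × ZMod 2) :
    -- the CSS code of `RM(m-3,m)`
    QCode.dual (QCode.reedMuller (m - 3) m) ≤ QCode.reedMuller (m - 3) m ∧
    QCode.IsStabilizerCode
      (QCode.cssCode (QCode.reedMuller (m - 3) m) (QCode.reedMuller (m - 3) m)) ∧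
    QCode.IsCode (QCode.cssCode (QCode.reedMuller (m - 3) m) (QCode.reedMuller (m - 3) m))
      (2 ^ m) (2 ^ (2 ^ m - 2 * m.choose 2 - 2 * m - 2)) 8 ∧
    -- the Goethals code as a union of cosets of `RM(m-3,m)`
    (∃ T, QCode.IsCosetDecomposition (QCode.reedMuller (m - 3) m) (QCode.goethals e) T) ∧
    (∀ T, QCode.IsCosetDecomposition (QCode.reedMuller (m - 3) m) (QCode.goethals e) T →
      T.card = 2 ^ (m.choose 2 - 2 * m + 2)) ∧
    -- the CSS-like union code
    ∀ T₁ T₂ : Finset ((Fin m → ZMod 2) → ZMod 2),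
      QCode.IsCosetDecomposition (QCode.reedMuller (m - 3) m) (QCode.goethals e) T₁ →
      QCode.IsCosetDecomposition (QCode.reedMuller (m - 3) m) (QCode.goethals e) T₂ →
      (∀ t ∈ T₁ ×ˢ T₂, ∀ t' ∈ T₁ ×ˢ T₂, t ≠ t' →
        QCode.translate (QCode.cssCode (QCode.reedMuller (m - 3) m) (QCode.reedMuller (m - 3) m)) t ⟂
          QCode.translate (QCode.cssCode (QCode.reedMuller (m - 3) m) (QCode.reedMuller (m - 3) m)) t') ∧
      QCode.IsCode
        (QCode.cssUnionCode (QCode.reedMuller (m - 3) m) (QCode.reedMuller (m - 3) m) T₁ T₂) (2 ^ m) (2 ^ (2 ^ m - 6 * m + 2)) 8 ∧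
      ¬ QCode.IsStabilizerCode
        (QCode.cssUnionCode (QCode.reedMuller (m - 3) m) (QCode.reedMuller (m - 3) m) T₁ T₂) ∧
      (m = 6 → QCode.IsCode
        (QCode.cssUnionCode (QCode.reedMuller (m - 3) m) (QCode.reedMuller (m - 3) m) T₁ T₂) 64 (2 ^ 30) 8) ∧
      (m = 8 → QCode.IsCode
        (QCode.cssUnionCode (QCode.reedMuller (m - 3) m) (QCode.reedMuller (m - 3) m) T₁ T₂) 256 (2 ^ 210) 8) := by
  obtain ⟨k, hmk⟩ : ∃ k, m = 2 * k + 4 := by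
    obtain ⟨i, hi⟩ := hme
    exact ⟨i - 2, by omega⟩
  have hk : 1 ≤ k := by omega
  rw [show m - 1 = 2 * k + 3 by omega] at hF
  have : Fact (Nat.Prime 2) := ⟨Nat.prime_two⟩
  have : CharP F 2 := charP_of_card_eq_prime_pow hF
  let _ : Algebra (ZMod 2) F := ZMod.algebra F 2
  have hR := QCode.dual_reedMuller_le hm
  have hadd : ∀ c ∈ QCode.reedMuller (m - 3) m, ∀ g ∈ QCode.goethals e,
      c + g ∈ QCode.goethals e := fun c hc g hg =>
    QCode.add_mem_goethals e hmk (by omega) hc hg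
  have h0 := QCode.zero_mem_goethals e hmk
  have hRG : ∀ c ∈ QCode.reedMuller (m - 3) m, c ∈ QCode.goethals e := fun c hc => by
    simpa using hadd c hc 0 h0
  have hdist : ∀ c ∈ QCode.goethals e, ∀ c' ∈ QCode.goethals e,
      (Finset.univ.filter fun i => (c - c') i ≠ 0).card < 8 → c = c' := fun c hc c' hc' h =>
    QCode.eq_of_mem_goethals e hmk hF hc hc' h
  obtain ⟨a, ha, ha', ha8⟩ := QCode.exists_weight_eight hm
  have hcardι : Fintype.card (Fin m → ZMod 2) = 2 ^ m := by simp [ZMod.card]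
  have hrank := QCode.finrank_reedMuller_sub_three hm
  have hrank' := QCode.finrank_reedMuller_ge hm
  have hchoose := QCode.choose_two_ge hm
  have hfinrank : Module.finrank ℂ
      (QCode.cssCode (QCode.reedMuller (m - 3) m) (QCode.reedMuller (m - 3) m)) =
      2 ^ (2 ^ m - 2 * m.choose 2 - 2 * m - 2) := by
    rw [QCode.finrank_cssCode hR, QCode.dual_reedMuller_sub_three hm, QCode.finrank_reedMuller_two]
    congr 1
    omega
  have hcosets : ∀ T, QCode.IsCosetDecomposition (QCode.reedMuller (m - 3) m) (QCode.goethals e) T →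
      T.card = 2 ^ (m.choose 2 - 2 * m + 2) := fun T hT => QCode.card_cosets e hmk hk hF hT
  refine ⟨hR, QCode.isStabilizerCode_cssCode hR, ⟨hcardι, hfinrank, ?_⟩,
    QCode.exists_isCosetDecomposition hadd, hcosets, ?_⟩
  -- The CSS code is itself the union code for `G = R` and `T₁ = T₂ = {0}`, so its distance follows
  -- from the same lemma.
  · have hT : QCode.IsCosetDecomposition (QCode.reedMuller (m - 3) m)
        (QCode.reedMuller (m - 3) m : Set ((Fin m → ZMod 2) → ZMod 2)) {0} := by
      refine ⟨?_, by simp⟩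
      ext v
      simp
    have h := QCode.hasMinDistance_cssUnionCode hR
      (fun c hc c' hc' => hdist c (hRG c hc) c' (hRG c' hc')) (fun c hc => hc) hT hT ha ha' ha8
    have heq : QCode.cssUnionCode (QCode.reedMuller (m - 3) m) (QCode.reedMuller (m - 3) m)
        {0} {0} = QCode.cssCode (QCode.reedMuller (m - 3) m) (QCode.reedMuller (m - 3) m) := by
      rw [QCode.cssUnionCode, QCode.unionCode_cssCode, ← QCode.syndromeSpace_zero]
      simp [Prod.mk_zero_zero]
    rwa [heq] at h
  · intro T₁ T₂ h₁ h₂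
    have hcode : QCode.IsCode (QCode.cssUnionCode (QCode.reedMuller (m - 3) m)
        (QCode.reedMuller (m - 3) m) T₁ T₂) (2 ^ m) (2 ^ (2 ^ m - 6 * m + 2)) 8 := by
      refine ⟨hcardι, ?_, QCode.hasMinDistance_cssUnionCode hR hdist hRG h₁ h₂ ha ha' ha8⟩
      rw [QCode.finrank_cssUnionCode h₁ h₂, hcosets T₁ h₁, hcosets T₂ h₂, hfinrank, ← pow_add,
        ← pow_add]
      congr 1
      omega
    obtain ⟨g, hg, g', hg', hgg⟩ := QCode.exists_add_notMem_goethals e hmk hk hF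
    refine ⟨QCode.translate_isOrtho h₁ h₂, hcode,
      QCode.not_isStabilizerCode_cssUnionCode hR h0 hg hg' hgg h₁ h₂, fun hm6 => ?_, fun hm8 => ?_⟩
    · have hn : 2 ^ m = 64 := by rw [hm6]; norm_num
      rwa [hn, show 64 - 6 * m + 2 = 30 by omega] at hcode
    · have hn : 2 ^ m = 256 := by rw [hm8]; norm_num
      rwa [hn, show 256 - 6 * m + 2 = 210 by omega] at hcode
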